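/- Let $0<\alpha<1$ and $G>0$. Consider $d$ assets with random return vector $r\in\mathbb R^d$, $\|r\|_2\le G$ almost surely, a portfolio $w\in\mathbb R^d$ with loss $L(w)=-w^\top r$, the Value-at-Risk $\mathrm{VaR}_\alpha(w)=\inf\{z\in\mathbb R:\Pr[L(w)\le z]\ge\alpha\}$, and the CVaR subgradient $g(w)=\mathbb E[\nabla_w L(w)\mid L(w)\ge \mathrm{VaR}_\alpha(w)]=\mathbb E[-r\mid L(w)\ge \mathrm{VaR}_\alpha(w)]$. Quantum access. For an unknown discrete return distribution with scenarios $r_i$ of probability $p_i$, $i\in\{0,1\}^n$, let $U$ be a unitary with $U|0^n\rangle=\sum_i\sqrt{p_i}\,|i\rangle$. For a payload $Y:\mathbb R^d\to[0,1]$ let $\mathcal A_Y$ be the circuit on scenario register, flag qubit and ancilla qubit that applies $U$, flips the flag if $L(w)\ge z$ for the threshold $z=\mathrm{VaR}_\alpha(w)$ (which is part of the given circuit), and, if the flag is $1$, rotates the ancilla by $|0\rangle\mapsto\sqrt{1-Y(r_i)}|0\rangle+\sqrt{Y(r_i)}|1\rangle$, so that the ancilla reads $1$ with probability $\mathbb E[Y(r)\mathbf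 1\{L(w)\ge z\}]$. Let $\mathcal Q_Y=\mathcal A_Y(2|0\rangle\langle 0|-1)\mathcal A_Y^\dagger S_\chi$, where $S_\chi$ flips the sign of the states with ancilla $1$. A quantum amplitude estimator of the iterative / maximum-likelihood type (no phase estimation) is a classical, possibly randomized, procedure that adaptively chooses $Y$ and $k$, measures the ancilla of $\mathcal Q_Y^k\mathcal A_Y|0\rangle$, post-processes the measured bits and outputs a vector $\tilde g(w)$; each such run costs $2k+1$ queries (applications of $\mathcal A_Y$ or $\mathcal A_Y^\dagger$). There is a constant $C$ depending only on $\alpha$ and $G$ such that for all $d$, all $\epsilon>0$ and all $0<\eta\le\frac12$: (i) there is such an estimator, using in the worst case at most $C\,\frac{d}{\epsilon}\log\frac1\eta$ quantum queries, whose output satisfies $\|\tilde g(w)-g(w)\|_2\le\epsilon$ with probability at least $1-\eta$, for every $n$, every $U$, every discrete return distribution as above and every $w$; (ii) in comparison, for every return distribution as above (discrete or not) and every $w$, the classical Monte Carlo estimator, that is, the average of $-r$ over those of $N$ independent samples of $r$ that satisfy $L(w)\ge\mathrm{VaR}_\alpha(w)$ (and $0$ if there are none), is within $\epsilon$ of $g(w)$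 in $\|\cdot\|_2$ with probability at least $1-\eta$ as soon as $N\ge C\,\frac{d}{\epsilon^2}\log\frac1\eta$; for fixed $\eta$ this is $O(d/\epsilon^2)$ samples. -/

import Mathlib

open MeasureTheory ProbabilityTheory
open scoped Kronecker

noncomputable section

/-- The portfolio loss `L(w) = -wᵀ r` at the return vector `r`. -/
def portfolioLoss {d : ℕ} (w r : EuclideanSpace ℝ (Fin d)) : ℝ :=
  -(inner ℝ w r)

/-- The tail event `{L(w) ≥ z}`, as a set of return vectors. -/
def tailEvent {d : ℕ} (w : EuclideanSpace ℝ (Fin d)) (z : ℝ) :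
    Set (EuclideanSpace ℝ (Fin d)) :=
  {r | z ≤ portfolioLoss w r}

/-- `VaR_α(w) = inf {z : Pr[L(w) ≤ z] ≥ α}` for returns distributed according to `D`. -/
def valueAtRisk {d : ℕ} (α : ℝ) (D : Measure (EuclideanSpace ℝ (Fin d)))
    (w : EuclideanSpace ℝ (Fin d)) : ℝ :=
  sInf {z : ℝ | α ≤ D.real {r | portfolioLoss w r ≤ z}}

/-- The Rockafellar--Uryasev subgradient `g(w) = E[∇_w L(w) | L(w) ≥ VaR_α(w)]` of CVaR; for the
linear loss `∇_w L(w) = -r`. -/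
def cvarSubgradient {d : ℕ} (α : ℝ) (D : Measure (EuclideanSpace ℝ (Fin d)))
    (w : EuclideanSpace ℝ (Fin d)) : EuclideanSpace ℝ (Fin d) :=
  ∫ r, -r ∂(cond D (tailEvent w (valueAtRisk α D w)))

/-! ### Quantum access to the return distribution -/

/-- Computational basis states of `n` qubits. -/
abbrev Bits (n : ℕ) : Type := Fin n → Bool

/-- Access to a discretized return distribution for `d` assets: the basis states of an `n`-qubit
register label scenarios, scenario `i` has return vector `ret i` and probability `p i`, and the
unitary `U` prepares `U |0ⁿ⟩ = ∑ᵢ √(p i) |i⟩`. -/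
structure ScenarioOracle (n d : ℕ) where
  ret : Bits n → EuclideanSpace ℝ (Fin d)
  p : Bits n → ℝ
  p_nonneg : ∀ i, 0 ≤ p i
  p_sum : ∑ i, p i = 1
  U : Matrix (Bits n) (Bits n) ℂ
  unitary : U ∈ Matrix.unitaryGroup (Bits n) ℂ
  prepares : ∀ i, U i (fun _ => false) = ((Real.sqrt (p i) : ℝ) : ℂ)

/-- The distribution of the return vector. -/
def ScenarioOracle.law {n d : ℕ} (O : ScenarioOracle n d) :
    Measure (EuclideanSpace ℝ (Fin d)) :=
  ∑ i, ENNReal.ofReal (O.p i) • Measure.dirac (O.ret i)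

/-- Basis states of the working space: scenario register, tail flag, payload ancilla. -/
abbrev WorkBasis (n : ℕ) : Type := Bits n × Bool × Bool

/-- The all-zero basis state. -/
def zeroState (n : ℕ) : WorkBasis n := (fun _ => false, false, false)

/-- The rotation with `|0⟩ ↦ √(1-y) |0⟩ + √y |1⟩` (rows index outputs, columns inputs). -/
def payloadRotation (y : ℝ) : Matrix Bool Bool ℂ :=
  fun b a => match b, a with
    | false, false => ((Real.sqrt (1 - y) : ℝ) : ℂ)
    | true, false => ((Real.sqrt y : ℝ) : ℂ)
    | false, true => -((Real.sqrt y : ℝ) : ℂ)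
    | true, true => ((Real.sqrt (1 - y) : ℝ) : ℂ)

/-- State preparation on the scenario register. -/
def prepGate {n d : ℕ} (O : ScenarioOracle n d) : Matrix (WorkBasis n) (WorkBasis n) ℂ :=
  O.U ⊗ₖ (1 : Matrix (Bool × Bool) (Bool × Bool) ℂ)

open Classical in
/-- The reversible comparator `|i⟩|f⟩|a⟩ ↦ |i⟩|f ⊕ 1{L(w) ≥ z}⟩|a⟩`. -/
def flagGate {n d : ℕ} (O : ScenarioOracle n d) (w : EuclideanSpace ℝ (Fin d)) (z : ℝ) :
    Matrix (WorkBasis n) (WorkBasis n) ℂ :=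
  fun x y =>
    if x = (y.1, xor y.2.1 (decide (O.ret y.1 ∈ tailEvent w z)), y.2.2) then 1 else 0

/-- Controlled on the flag, rotate the ancilla by the payload `Y(r) ∈ [0,1]`. -/
def payloadGate {n d : ℕ} (O : ScenarioOracle n d)
    (Y : EuclideanSpace ℝ (Fin d) → unitInterval) : Matrix (WorkBasis n) (WorkBasis n) ℂ :=
  fun x y =>
    if x.1 = y.1 ∧ x.2.1 = y.2.1 then
      (if y.2.1 = true then payloadRotation (Y (O.ret y.1)) else 1) x.2.2 y.2.2
    else 0

/-- The marking unitary `𝒜`: prepare the scenarios, flag the tail, apply the flagged payload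
rotation. On `|0⟩` its ancilla reads `1` with probability `E[Y(r) · 1{L(w) ≥ z}]`. -/
def markingUnitary {n d : ℕ} (O : ScenarioOracle n d) (w : EuclideanSpace ℝ (Fin d)) (z : ℝ)
    (Y : EuclideanSpace ℝ (Fin d) → unitInterval) : Matrix (WorkBasis n) (WorkBasis n) ℂ :=
  payloadGate O Y * flagGate O w z * prepGate O

/-- The reflection `2|0⟩⟨0| - 1`. -/
def zeroReflection (n : ℕ) : Matrix (WorkBasis n) (WorkBasis n) ℂ :=
  Matrix.diagonal fun x => if x = zeroState n then 1 else -1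

/-- The phase flip on the states whose ancilla is `1`. -/
def markReflection (n : ℕ) : Matrix (WorkBasis n) (WorkBasis n) ℂ :=
  Matrix.diagonal fun x => if x.2.2 = true then -1 else 1

/-- The Grover iterate `𝒬 = 𝒜 (2|0⟩⟨0| - 1) 𝒜† S_χ` of amplitude estimation. -/
def groverIterate {n d : ℕ} (O : ScenarioOracle n d) (w : EuclideanSpace ℝ (Fin d)) (z : ℝ)
    (Y : EuclideanSpace ℝ (Fin d) → unitInterval) : Matrix (WorkBasis n) (WorkBasis n) ℂ :=
  markingUnitary O w z Y * zeroReflection n * (markingUnitary O w z Y).conjTranspose *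
    markReflection n

/-- Born probability that measuring the ancilla of `𝒬ᵏ 𝒜 |0⟩` gives the bit `b`. -/
def measureProb {n d : ℕ} (O : ScenarioOracle n d) (w : EuclideanSpace ℝ (Fin d)) (z : ℝ)
    (Y : EuclideanSpace ℝ (Fin d) → unitInterval) (k : ℕ) (b : Bool) : ℝ :=
  ∑ i : Bits n, ∑ f : Bool,
    ‖(groverIterate O w z Y ^ k * markingUnitary O w z Y) (i, f, b) (zeroState n)‖ ^ 2

/-! ### Amplitude estimation without phase estimation -/

/-- An estimator based on amplitude estimation of the iterative / maximum-likelihood type: a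
classical, possibly randomized, procedure that adaptively chooses payloads `Y` and powers `k`, runs
the circuit `𝒬ᵏ 𝒜 |0⟩` for that payload, measures the ancilla, continues according to the bit
that it reads, and finally outputs a vector. The procedure sees the return distribution only
through the measured bits. -/
inductive QAEstimator (d : ℕ) : Type
  | output (v : EuclideanSpace ℝ (Fin d)) : QAEstimator d
  | toss (next : Bool → QAEstimator d) : QAEstimator d
  | run (Y : EuclideanSpace ℝ (Fin d) → unitInterval) (k : ℕ) (next : Bool → QAEstimator d) :
      QAEstimator d

/-- Worst-case number of quantum queries, that is, of applications of `𝒜` and `𝒜†` (each of which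
uses the state preparation, or its inverse, once): `𝒬ᵏ 𝒜 |0⟩` takes `2k + 1` of them. -/
def QAEstimator.queries {d : ℕ} : QAEstimator d → ℕ
  | .output _ => 0
  | .toss next => max (next false).queries (next true).queries
  | .run _ k next => (2 * k + 1) + max (next false).queries (next true).queries

open Classical in
/-- Probability that the output lies in `S`, when the circuits are built from the oracle `O`, the
portfolio `w` and the tail threshold `z`; a toss is a fair coin. -/
def QAEstimator.prob {n d : ℕ} (O : ScenarioOracle n d) (w : EuclideanSpace ℝ (Fin d)) (z : ℝ)
    (S : Set (EuclideanSpace ℝ (Fin d))) : QAEstimator d → ℝ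
  | .output v => if v ∈ S then 1 else 0
  | .toss next => ∑ b : Bool, (1 / 2 : ℝ) * (next b).prob O w z S
  | .run Y k next => ∑ b : Bool, measureProb O w z Y k b * (next b).prob O w z S

/-! ### Classical Monte Carlo -/

open Classical in
/-- The Monte Carlo estimator of `E[∇_w L(w) | L(w) ≥ z]`: the average of `-r` over those of the
`N` sampled return vectors that lie in the tail (and `0` if none does). -/
def monteCarloEstimator {N d : ℕ} (w : EuclideanSpace ℝ (Fin d)) (z : ℝ)
    (x : Fin N → EuclideanSpace ℝ (Fin d)) : EuclideanSpace ℝ (Fin d) :=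
  ((Finset.univ.filter fun i => x i ∈ tailEvent w z).card : ℝ)⁻¹ •
    ∑ i ∈ Finset.univ.filter fun i => x i ∈ tailEvent w z, -(x i)

end

/-!
The classical part is a Hoeffding bound. The samples in the tail, centered at the subgradient `g`,
have mean zero, so the error is a centered sum divided by the number of samples in the tail, and the
latter is at least `N (1 - α) / 2` up to an exponentially small probability, because the tail beyond
the Value-at-Risk has probability at least `1 - α` (`one_sub_le_tail_valueAtRisk`). For the norm of
the sum, `cosh (c ‖v‖ / √d)` is at most the average of `cosh (c v_j)` over the coordinates
(`cosh_norm_le`), which reduces the vector bound to the scalar one and costs the factor `d` that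
the statement allows (`monteCarlo_le`).

For the quantum part, write `g = m / q` with the tail mean `m = E[-r · 1{L(w) ≥ z}]` and the tail
probability `q ≥ 1 - α`. The Grover iterate rotates the prepared state by twice the angle `θ` with
`sin² θ = E[Y(r) · 1{L(w) ≥ z}]`, so that `k` iterations give a bit with probability
`sin² ((2k+1)θ)` (`measureProb_eq`). The difficulty is to stay within `O(d / ε · log (1 / η))`
queries, without further powers of `d` and without logarithms of `d` or `1 / ε`. This rests on
three points.

* Amplitude estimation without logarithms (`exists_amplitudeEstimation`): a noisy ternary search for
  `√p` which spends more repetitions on the early steps than on the late ones has mean square error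
  `O(p / M² + 1 / M⁴)` with `O(M)` queries. The payload may be rescaled, which keeps the rotation
  angle away from the points where the hit probability is not monotone.
* Estimating each of `d` coordinates of size `G` separately up to `ε / √d` would be too costly. A
  Hadamard matrix with random column signs turns `r` into coordinates that are sub-Gaussian of size
  `‖r‖ / √d`. Each coordinate is split into dyadic levels; high levels have tiny amplitudes, hence
  tiny errors `√p / M`, and need geometrically fewer queries. In this way each coordinate is
  estimated up to `O(G / (M √d))` with `O(M)` queries, and the vector up to `O(G / M)`
  (`exists_tailMeanEstimation`). Mean square errors add up over the coordinates, so no union bound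
  is needed.
* The success probability is raised only at the end, for the whole vector, by choosing among
  `O(log (1 / η))` independent outputs one that is close to more than half of them
  (`norm_clusterPoint_sub_le`, `expect_clusterPoint_le`).
-/

noncomputable section

/-! ### Procedures and their expected values -/

/-- Payload functions, the parameters of the marking circuit. -/
abbrev Payload (d : ℕ) : Type := EuclideanSpace ℝ (Fin d) → unitInterval

/-- Probability `sin² ((2k+1) θ)`, with `sin² θ = p`, that the ancilla reads `1` after `k` Grover
iterations on a state whose marked part has weight `p`. -/
def hitProb (p : ℝ) (k : ℕ) : ℝ :=
  Real.sin ((2 * k + 1) * Real.arcsin (Real.sqrt p)) ^ 2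

lemma hitProb_nonneg (p : ℝ) (k : ℕ) : 0 ≤ hitProb p k := sq_nonneg _

lemma hitProb_le_one (p : ℝ) (k : ℕ) : hitProb p k ≤ 1 := Real.sin_sq_le_one _

/-- Amplitude estimation procedures with outputs in an arbitrary type. In contrast to `QAEstimator`
they can be composed sequentially. -/
inductive Proc (d : ℕ) (β : Type) : Type
  | ret (b : β) : Proc d β
  | toss (next : Bool → Proc d β) : Proc d β
  | run (Y : Payload d) (k : ℕ) (next : Bool → Proc d β) : Proc d β

namespace Proc

variable {d : ℕ} {β γ : Type}

/-- Sequential composition. -/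
def bind : Proc d β → (β → Proc d γ) → Proc d γ
  | .ret b, F => F b
  | .toss next, F => .toss fun b => (next b).bind F
  | .run Y k next, F => .run Y k fun b => (next b).bind F

/-- Classical post-processing of the output. -/
def map (F : β → γ) (x : Proc d β) : Proc d γ := x.bind fun b => .ret (F b)

/-- Worst-case number of applications of the marking circuit or its inverse. -/
def queries : Proc d β → ℕ
  | .ret _ => 0
  | .toss next => max (next false).queries (next true).queries
  | .run _ k next => (2 * k + 1) + max (next false).queries (next true).queries

/-- Expected value of `f` at the output, when the circuit with payload `Y` marks weight `a Y`. -/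
def expect (a : Payload d → ℝ) (f : β → ℝ) : Proc d β → ℝ
  | .ret b => f b
  | .toss next => 1 / 2 * (next true).expect a f + 1 / 2 * (next false).expect a f
  | .run Y k next => hitProb (a Y) k * (next true).expect a f +
      (1 - hitProb (a Y) k) * (next false).expect a f

lemma queries_bind_le (x : Proc d β) (F : β → Proc d γ) (B : ℕ) (h : ∀ b, (F b).queries ≤ B) :
    (x.bind F).queries ≤ x.queries + B := by
  induction x with
  | ret b => simpa [bind, queries] using h b
  | toss next ih => simp only [bind, queries]; have := ih true; have := ih false; omega
  | run Y k next ih => simp only [bind, queries]; have := ih true; have := ih false; omega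

lemma queries_map (x : Proc d β) (F : β → γ) : (x.map F).queries = x.queries := by
  unfold map
  induction x with
  | ret b => rfl
  | toss next ih => simp only [bind, queries, ih]
  | run Y k next ih => simp only [bind, queries, ih]

variable (a : Payload d → ℝ)

lemma expect_bind (x : Proc d β) (F : β → Proc d γ) (f : γ → ℝ) :
    (x.bind F).expect a f = x.expect a fun b => (F b).expect a f := by
  induction x with
  | ret b => rfl
  | toss next ih => simp only [bind, expect, ih]
  | run Y k next ih => simp only [bind, expect, ih]

lemma expect_map (x : Proc d β) (F : β → γ) (f : γ → ℝ) :
    (x.map F).expect a f = x.expect a fun b => f (F b) := expect_bind a x _ f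

lemma expect_const (x : Proc d β) (c : ℝ) : (x.expect a fun _ => c) = c := by
  induction x with
  | ret b => rfl
  | toss next ih => simp only [expect, ih]; ring
  | run Y k next ih => simp only [expect, ih]; ring

lemma expect_add (x : Proc d β) (f g : β → ℝ) :
    (x.expect a fun b => f b + g b) = x.expect a f + x.expect a g := by
  induction x with
  | ret b => rfl
  | toss next ih => simp only [expect, ih]; ring
  | run Y k next ih => simp only [expect, ih]; ring

lemma expect_const_mul (x : Proc d β) (c : ℝ) (f : β → ℝ) :
    (x.expect a fun b => c * f b) = c * x.expect a f := by
  induction x with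
  | ret b => rfl
  | toss next ih => simp only [expect, ih]; ring
  | run Y k next ih => simp only [expect, ih]; ring

lemma expect_sum {ι : Type} (s : Finset ι) (x : Proc d β) (f : ι → β → ℝ) :
    (x.expect a fun b => ∑ i ∈ s, f i b) = ∑ i ∈ s, x.expect a (f i) := by
  classical
  induction s using Finset.induction_on with
  | empty => simpa using expect_const a x 0
  | insert i s hi ih =>
    simp only [Finset.sum_insert hi]
    rw [expect_add, ih]

lemma expect_mono (x : Proc d β) {f g : β → ℝ} (h : ∀ b, f b ≤ g b) :
    x.expect a f ≤ x.expect a g := by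
  induction x with
  | ret b => exact h b
  | toss next ih => simp only [expect]; linarith [ih true, ih false]
  | run Y k next ih =>
    simp only [expect]
    exact add_le_add (mul_le_mul_of_nonneg_left (ih true) (hitProb_nonneg _ _))
      (mul_le_mul_of_nonneg_left (ih false) (by linarith [hitProb_le_one (a Y) k]))

lemma expect_nonneg (x : Proc d β) {f : β → ℝ} (h : ∀ b, 0 ≤ f b) : 0 ≤ x.expect a f := by
  simpa [expect_const] using expect_mono a x h

/-- Independent runs of finitely many procedures. -/
def piFin : {n : ℕ} → (Fin n → Proc d β) → Proc d (Fin n → β)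
  | 0, _ => .ret Fin.elim0
  | _ + 1, x => (x 0).bind fun b => (piFin fun i => x i.succ).map fun v => Fin.cons b v

/-- Independence of the runs. -/
lemma expect_piFin_prod {n : ℕ} (x : Fin n → Proc d β) (F : Fin n → β → ℝ) :
    ((piFin x).expect a fun v => ∏ i, F i (v i)) = ∏ i, (x i).expect a (F i) := by
  induction n with
  | zero => simp [piFin, expect]
  | succ n ih =>
    simp only [piFin, expect_bind, expect_map, Fin.prod_univ_succ, Fin.cons_zero, Fin.cons_succ]
    simp only [expect_const_mul]
    rw [ih (fun i => x i.succ) (fun i => F i.succ)]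
    simp only [mul_comm _ (∏ i, _)]
    rw [expect_const_mul]

lemma queries_piFin_le {n : ℕ} (x : Fin n → Proc d β) : (piFin x).queries ≤ ∑ i, (x i).queries := by
  induction n with
  | zero => simp [piFin, queries]
  | succ n ih =>
    rw [Fin.sum_univ_succ, piFin]
    exact queries_bind_le _ _ _ fun b => by rw [queries_map]; exact ih _

variable {ι : Type} [Fintype ι]

/-- Independent runs of a finite family of procedures. -/
def pi (x : ι → Proc d β) : Proc d (ι → β) :=
  (piFin fun i => x ((Fintype.equivFin ι).symm i)).map fun v i => v (Fintype.equivFin ι i)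

lemma expect_pi_prod (x : ι → Proc d β) (F : ι → β → ℝ) :
    ((pi x).expect a fun v => ∏ i, F i (v i)) = ∏ i, (x i).expect a (F i) := by
  rw [pi, expect_map, ← (Fintype.equivFin ι).symm.prod_comp, ← expect_piFin_prod]
  congr 1
  funext v
  rw [← (Fintype.equivFin ι).symm.prod_comp]
  simp

lemma expect_pi_apply (x : ι → Proc d β) (i : ι) (f : β → ℝ) :
    ((pi x).expect a fun v => f (v i)) = (x i).expect a f := by
  classical
  have h := expect_pi_prod a x fun j b => if j = i then f b else 1
  rw [Finset.prod_eq_single i] at h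
  · simp only [Finset.prod_ite_eq', Finset.mem_univ, if_true] at h
    exact h
  · intro j _ hj
    simpa [hj] using expect_const a (x j) 1
  · simp

lemma queries_pi_le (x : ι → Proc d β) : (pi x).queries ≤ ∑ i, (x i).queries := by
  rw [pi, queries_map]
  refine (queries_piFin_le _).trans (le_of_eq ?_)
  exact (Fintype.equivFin ι).symm.sum_comp fun i => (x i).queries

/-- A procedure with vector outputs as an estimator. -/
def toEstimator : Proc d (EuclideanSpace ℝ (Fin d)) → QAEstimator d
  | .ret v => .output v
  | .toss next => .toss fun b => (next b).toEstimator
  | .run Y k next => .run Y k fun b => (next b).toEstimator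

lemma queries_toEstimator (x : Proc d (EuclideanSpace ℝ (Fin d))) :
    x.toEstimator.queries = x.queries := by
  induction x with
  | ret b => rfl
  | toss next ih => simp only [toEstimator, queries, QAEstimator.queries, ih]
  | run Y k next ih => simp only [toEstimator, queries, QAEstimator.queries, ih]

end Proc

/-! ### Grover iterations -/

section Grover

open Matrix

variable {n d : ℕ} (O : ScenarioOracle n d) (w : EuclideanSpace ℝ (Fin d)) (z : ℝ)

open Classical in
/-- The sub-probability weight of scenario `i` on the tail event. -/
def tailWeight (i : Bits n) : ℝ := if O.ret i ∈ tailEvent w z then O.p i else 0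

/-- The weight `E[Y(r) · 1{L(w) ≥ z}]` marked by the circuit with payload `Y`. -/
def markedWeight (Y : Payload d) : ℝ := ∑ i, tailWeight O w z i * (Y (O.ret i) : ℝ)

lemma payloadRotation_mul_conjTranspose {y : ℝ} (h0 : 0 ≤ y) (h1 : y ≤ 1) :
    payloadRotation y * (payloadRotation y)ᴴ = 1 := by
  have e1 : ((Real.sqrt y : ℝ) : ℂ) * ((Real.sqrt y : ℝ) : ℂ) = (y : ℂ) := by
    rw [← Complex.ofReal_mul, Real.mul_self_sqrt h0]
  have e2 : ((Real.sqrt (1 - y) : ℝ) : ℂ) * ((Real.sqrt (1 - y) : ℝ) : ℂ) = ((1 - y : ℝ) : ℂ) := by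
    rw [← Complex.ofReal_mul, Real.mul_self_sqrt (by linarith)]
  ext b c
  cases b <;> cases c <;>
    simp [Matrix.mul_apply, payloadRotation, Matrix.conjTranspose_apply, e1, e2] <;> ring

lemma payloadGate_mul_conjTranspose (Y : Payload d) :
    payloadGate O Y * (payloadGate O Y)ᴴ = 1 := by
  ext ⟨i, f, b⟩ ⟨i', f', b'⟩
  have key : ∀ f, ((if f = true then payloadRotation (Y (O.ret i)) else 1) *
      (if f = true then payloadRotation (Y (O.ret i)) else 1)ᴴ : Matrix Bool Bool ℂ) b b' =
      (1 : Matrix Bool Bool ℂ) b b' := by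
    intro f
    cases f
    · simp
    · simp [payloadRotation_mul_conjTranspose (Y (O.ret i)).2.1 (Y (O.ret i)).2.2]
  have k := key f
  rw [Matrix.mul_apply] at k
  rw [Matrix.mul_apply, Fintype.sum_prod_type]
  simp only [Fintype.sum_prod_type]
  rw [Finset.sum_eq_single i]
  · rw [Finset.sum_eq_single f]
    · by_cases h : i = i' ∧ f = f'
      · obtain ⟨rfl, rfl⟩ := h
        simp only [payloadGate, and_self, if_true, conjTranspose_apply] at k ⊢
        rw [k]
        simp [Matrix.one_apply]
      · have : ¬ (i' = i ∧ f' = f) := fun hh => h ⟨hh.1.symm, hh.2.symm⟩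
        have h3 : ¬ ((i, f, b) = (i', f', b')) := fun hh => h (by simp_all)
        simp [payloadGate, this, h3]
    · intro f1 _ h
      simp [payloadGate, Ne.symm h]
    · simp
  · intro i1 _ h
    simp [payloadGate, Ne.symm h]
  · simp

lemma flagGate_mul_conjTranspose : flagGate O w z * (flagGate O w z)ᴴ = 1 := by
  classical
  -- the comparator permutes the basis states, and is its own inverse
  let σ : WorkBasis n → WorkBasis n := fun y =>
    (y.1, xor y.2.1 (decide (O.ret y.1 ∈ tailEvent w z)), y.2.2)
  have hσ : ∀ y, σ (σ y) = y := by
    rintro ⟨i, f, b⟩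
    simp [σ]
  have hF : ∀ x y, flagGate O w z x y = if σ x = y then 1 else 0 := by
    intro x y
    have : x = σ y ↔ σ x = y := ⟨fun h => by rw [h, hσ], fun h => by rw [← h, hσ]⟩
    simp only [flagGate]
    exact if_congr this rfl rfl
  ext x y
  rw [Matrix.mul_apply]
  simp only [conjTranspose_apply, hF, Matrix.one_apply]
  have : x = y ↔ σ x = σ y := ⟨fun h => by rw [h], fun h => by rw [← hσ x, h, hσ]⟩
  simp [this]

lemma prepGate_mul_conjTranspose : prepGate O * (prepGate O)ᴴ = 1 := by
  have h : O.U * O.Uᴴ = 1 := Matrix.mem_unitaryGroup_iff.1 O.unitary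
  rw [prepGate, conjTranspose_kronecker, ← Matrix.mul_kronecker_mul, h]
  simp

lemma markingUnitary_mul_conjTranspose (Y : Payload d) :
    markingUnitary O w z Y * (markingUnitary O w z Y)ᴴ = 1 := by
  rw [markingUnitary, conjTranspose_mul, conjTranspose_mul]
  calc _ = payloadGate O Y * (flagGate O w z * (prepGate O * (prepGate O)ᴴ) * (flagGate O w z)ᴴ) *
        (payloadGate O Y)ᴴ := by simp only [Matrix.mul_assoc]
    _ = 1 := by
      rw [prepGate_mul_conjTranspose, Matrix.mul_one, flagGate_mul_conjTranspose, Matrix.mul_one,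
        payloadGate_mul_conjTranspose]

open Classical in
/-- The amplitudes of the state `ψ` prepared by the marking circuit. -/
lemma markingUnitary_zeroState (Y : Payload d) (i : Bits n) (f b : Bool) :
    markingUnitary O w z Y (i, f, b) (zeroState n) =
      if f = decide (O.ret i ∈ tailEvent w z) then
        ((Real.sqrt (O.p i) : ℝ) : ℂ) *
          (if f = true then payloadRotation (Y (O.ret i)) else 1) b false
      else 0 := by
  have h1 : ∀ j : WorkBasis n, prepGate O j (zeroState n) =
      if j.2 = (false, false) then ((Real.sqrt (O.p j.1) : ℝ) : ℂ) else 0 := by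
    rintro ⟨j, f, b⟩
    simp [prepGate, zeroState, Matrix.kroneckerMap_apply, O.prepares, Matrix.one_apply]
  have h2 : ∀ j : WorkBasis n, (flagGate O w z * prepGate O) j (zeroState n) =
      if j.2 = (decide (O.ret j.1 ∈ tailEvent w z), false) then
        ((Real.sqrt (O.p j.1) : ℝ) : ℂ) else 0 := by
    rintro ⟨j, f, b⟩
    rw [Matrix.mul_apply, Finset.sum_eq_single (j, false, false)]
    · rw [h1]
      simp [flagGate, Prod.ext_iff]
    · rintro ⟨j', f', b'⟩ - hne
      rw [h1]
      by_cases hh : (f', b') = (false, false)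
      · have : j ≠ j' := by rintro rfl; exact hne (by rw [hh])
        simp [flagGate, this]
      · simp [hh]
    · simp
  rw [markingUnitary, Matrix.mul_assoc, Matrix.mul_apply,
    Finset.sum_eq_single (i, decide (O.ret i ∈ tailEvent w z), false)]
  · rw [h2]
    by_cases hf : f = decide (O.ret i ∈ tailEvent w z)
    · subst hf
      simp only [payloadGate, and_self, if_true]
      rw [mul_comm]
    · simp [payloadGate, hf]
  · rintro ⟨j', f', b'⟩ - hne
    rw [h2]
    by_cases hh : (f', b') = (decide (O.ret j' ∈ tailEvent w z), false)
    · have : i ≠ j' := by rintro rfl; exact hne (by rw [hh])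
      simp [payloadGate, this]
    · simp only [hh, if_false, mul_zero]
  · simp

lemma sum_normSq_ancilla_true (Y : Payload d) :
    ∑ i : Bits n, ∑ f : Bool, ‖markingUnitary O w z Y (i, f, true) (zeroState n)‖ ^ 2 =
      markedWeight O w z Y := by
  classical
  rw [markedWeight]
  refine Finset.sum_congr rfl fun i _ => ?_
  simp only [markingUnitary_zeroState, Fintype.sum_bool, tailWeight]
  have hY := (Y (O.ret i)).2.1
  by_cases h : O.ret i ∈ tailEvent w z <;>
    simp [h, payloadRotation, mul_pow, Real.sq_sqrt, O.p_nonneg i, hY]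

lemma sum_normSq_ancilla_false (Y : Payload d) :
    ∑ i : Bits n, ∑ f : Bool, ‖markingUnitary O w z Y (i, f, false) (zeroState n)‖ ^ 2 =
      1 - markedWeight O w z Y := by
  classical
  rw [markedWeight, ← O.p_sum, ← Finset.sum_sub_distrib]
  refine Finset.sum_congr rfl fun i _ => ?_
  simp only [markingUnitary_zeroState, Fintype.sum_bool, tailWeight]
  have hY := (Y (O.ret i)).2.2
  by_cases h : O.ret i ∈ tailEvent w z
  · simp only [h, decide_true, if_true, payloadRotation]
    simp [mul_pow, Real.sq_sqrt, O.p_nonneg i, hY]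
    ring
  · simp [h, Real.sq_sqrt, O.p_nonneg i]

lemma markedWeight_nonneg (Y : Payload d) : 0 ≤ markedWeight O w z Y := by
  rw [← sum_normSq_ancilla_true]
  positivity

lemma markedWeight_le_one (Y : Payload d) : markedWeight O w z Y ≤ 1 := by
  have := sum_normSq_ancilla_false O w z Y
  have h : 0 ≤ 1 - markedWeight O w z Y := by rw [← this]; positivity
  linarith

/-- The Grover iterate acts by `v ↦ 2⟨ψ, S v⟩ ψ - S v`, where `ψ = 𝒜|0⟩` and `S` is the phase flip:
`𝒜 (2|0⟩⟨0| - 1) 𝒜†` is the reflection `2|ψ⟩⟨ψ| - 1`, by unitarity of `𝒜`. -/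
lemma groverIterate_mulVec (Y : Payload d) (v : WorkBasis n → ℂ) (x : WorkBasis n) :
    (groverIterate O w z Y *ᵥ v) x =
      2 * (∑ y, star (markingUnitary O w z Y y (zeroState n)) *
        ((if y.2.2 = true then -1 else 1) * v y)) * markingUnitary O w z Y x (zeroState n) -
      (if x.2.2 = true then -1 else 1) * v x := by
  set A := markingUnitary O w z Y with hA
  set Sv : WorkBasis n → ℂ := fun y => (if y.2.2 = true then -1 else 1) * v y with hSv
  have hS : markReflection n *ᵥ v = Sv := by
    ext y; rw [markReflection, mulVec_diagonal]
  have hZ : ∀ u : WorkBasis n → ℂ, zeroReflection n *ᵥ u =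
      (2 * u (zeroState n)) • (Pi.single (zeroState n) 1 : WorkBasis n → ℂ) - u := by
    intro u
    ext y
    rw [zeroReflection, mulVec_diagonal]
    by_cases h : y = zeroState n
    · subst h; simp; ring
    · simp [h]
  have e : groverIterate O w z Y *ᵥ v =
      A *ᵥ (zeroReflection n *ᵥ (Aᴴ *ᵥ (markReflection n *ᵥ v))) := by
    simp only [groverIterate, mulVec_mulVec, ← hA, Matrix.mul_assoc]
  have hAA : A *ᵥ (Aᴴ *ᵥ Sv) = Sv := by
    rw [mulVec_mulVec, hA, markingUnitary_mul_conjTranspose, one_mulVec]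
  rw [e, hS, hZ, mulVec_sub, mulVec_smul, hAA, mulVec_single_one]
  simp [Matrix.mulVec, dotProduct, hSv, conjTranspose_apply]

/-- The Grover iterates rotate the prepared state in the plane of its marked and unmarked parts:
these are rescaled by `a = sin ((2k+1)θ) / sin θ` and `b = cos ((2k+1)θ) / cos θ`. The products
`a sin θ` and `b cos θ` avoid the division, so that `θ = 0` and `θ = π / 2` need no separate
treatment. -/
lemma groverIterate_pow_zeroState (Y : Payload d) (θ : ℝ)
    (hθ : Real.sin θ ^ 2 = markedWeight O w z Y) (k : ℕ) :
    ∃ a b : ℝ, a * Real.sin θ = Real.sin ((2 * k + 1) * θ) ∧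
      b * Real.cos θ = Real.cos ((2 * k + 1) * θ) ∧
      ∀ x, (groverIterate O w z Y ^ k * markingUnitary O w z Y) x (zeroState n) =
        (if x.2.2 = true then (a : ℂ) else (b : ℂ)) * markingUnitary O w z Y x (zeroState n) := by
  induction k with
  | zero => exact ⟨1, 1, by simp, by simp, by simp⟩
  | succ k ih =>
    obtain ⟨a, b, ha, hb, h⟩ := ih
    set p := markedWeight O w z Y with hp
    have hc : Real.cos θ ^ 2 = 1 - p := by rw [← hθ, Real.cos_sq']
    have hcast : (2 * ((k + 1 : ℕ) : ℝ) + 1) * θ = (2 * k + 1) * θ + 2 * θ := by push_cast; ring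
    have hc2 : Real.cos (2 * θ) = 1 - 2 * p := by rw [Real.cos_two_mul, hc]; ring
    refine ⟨(1 - 2 * p) * a + 2 * (1 - p) * b, (1 - 2 * p) * b - 2 * p * a, ?_, ?_, ?_⟩
    · rw [hcast, Real.sin_add, ← ha, ← hb, hc2, Real.sin_two_mul, ← hc]; ring
    · rw [hcast, Real.cos_add, ← ha, ← hb, hc2, Real.sin_two_mul, ← hθ]; ring
    · intro x
      have e1 : (groverIterate O w z Y ^ (k + 1) * markingUnitary O w z Y) x (zeroState n) =
          (groverIterate O w z Y *ᵥ
            fun y => (groverIterate O w z Y ^ k * markingUnitary O w z Y) y (zeroState n)) x := by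
        rw [pow_succ', Matrix.mul_assoc, Matrix.mul_apply]; rfl
      have e2 : ∑ y : WorkBasis n, star (markingUnitary O w z Y y (zeroState n)) *
          ((if y.2.2 = true then -1 else 1) * ((if y.2.2 = true then (a : ℂ) else (b : ℂ)) *
            markingUnitary O w z Y y (zeroState n))) = (((1 - p) * b - p * a : ℝ) : ℂ) := by
        have e3 : ∀ y : WorkBasis n, star (markingUnitary O w z Y y (zeroState n)) *
          ((if y.2.2 = true then -1 else 1) * ((if y.2.2 = true then (a : ℂ) else (b : ℂ)) *
            markingUnitary O w z Y y (zeroState n))) =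
            (((if y.2.2 = true then -a else b) *
              ‖markingUnitary O w z Y y (zeroState n)‖ ^ 2 : ℝ) : ℂ) := by
          intro y
          have := Complex.conj_mul' (markingUnitary O w z Y y (zeroState n))
          have h4 : star (markingUnitary O w z Y y (zeroState n)) *
            markingUnitary O w z Y y (zeroState n) =
            (‖markingUnitary O w z Y y (zeroState n)‖ : ℂ) ^ 2 := this
          by_cases hy : y.2.2 = true
          · simp only [hy, if_true]; push_cast; rw [← h4]; ring
          · simp only [hy]; push_cast; rw [← h4]; simp; ring
        rw [Finset.sum_congr rfl fun y _ => e3 y, ← Complex.ofReal_sum]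
        congr 1
        rw [← sum_normSq_ancilla_false O w z Y, hp, ← sum_normSq_ancilla_true O w z Y]
        simp only [Fintype.sum_prod_type, Fintype.sum_bool, Finset.sum_mul, ← Finset.sum_sub_distrib]
        refine Finset.sum_congr rfl fun i _ => ?_
        simp only [if_true, Bool.false_eq_true, if_false]
        ring
      rw [e1, groverIterate_mulVec]
      simp only [h]
      rw [e2]
      by_cases hx : x.2.2 = true
      · simp only [hx, if_true]; push_cast; ring
      · simp only [hx]; push_cast; simp; ring

lemma sin_arcsin_sqrt_markedWeight (Y : Payload d) :
    Real.sin (Real.arcsin (Real.sqrt (markedWeight O w z Y))) ^ 2 = markedWeight O w z Y := by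
  have h0 := markedWeight_nonneg O w z Y
  rw [Real.sin_arcsin (by linarith [Real.sqrt_nonneg (markedWeight O w z Y)])
    (Real.sqrt_le_one.2 (markedWeight_le_one O w z Y)), Real.sq_sqrt h0]

/-- After `k` Grover iterations the ancilla reads `1` with probability `sin² ((2k+1)θ)`, where
`sin² θ` is the marked weight. -/
lemma measureProb_eq (Y : Payload d) (k : ℕ) :
    measureProb O w z Y k true = hitProb (markedWeight O w z Y) k ∧
    measureProb O w z Y k false = 1 - hitProb (markedWeight O w z Y) k := by
  have hθ := sin_arcsin_sqrt_markedWeight O w z Y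
  obtain ⟨a, b, ha, hb, h⟩ := groverIterate_pow_zeroState O w z Y _ hθ k
  constructor
  · simp only [measureProb, h, if_true, norm_mul, mul_pow, ← Finset.mul_sum,
      sum_normSq_ancilla_true]
    rw [hitProb, ← ha, mul_pow, hθ]
    simp
  · simp only [measureProb, h, Bool.false_eq_true, if_false, norm_mul, mul_pow, ← Finset.mul_sum,
      sum_normSq_ancilla_false]
    rw [hitProb, ← Real.cos_sq', ← hb, mul_pow, Real.cos_sq', hθ]
    simp

open Classical in
/-- The output distribution of an estimator depends on the oracle only through the marked
weights. -/
lemma Proc.prob_toEstimator (S : Set (EuclideanSpace ℝ (Fin d)))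
    (x : Proc d (EuclideanSpace ℝ (Fin d))) :
    x.toEstimator.prob O w z S =
      x.expect (markedWeight O w z) fun v => if v ∈ S then 1 else 0 := by
  induction x with
  | ret b => rfl
  | toss next ih => simp only [toEstimator, expect, QAEstimator.prob, ih, Fintype.sum_bool]
  | run Y k next ih =>
    simp only [toEstimator, expect, QAEstimator.prob, ih, Fintype.sum_bool,
      (measureProb_eq O w z Y k).1, (measureProb_eq O w z Y k).2]

end Grover

/-! ### Amplitude estimation by noisy ternary search -/

lemma sub_le_arcsin_sub {x y : ℝ} (hx : 0 ≤ x) (hxy : x ≤ y) (hy : y ≤ 1) :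
    y - x ≤ Real.arcsin y - Real.arcsin x := by
  have h := Real.abs_sin_sub_sin_le (Real.arcsin y) (Real.arcsin x)
  rwa [Real.sin_arcsin (by linarith) hy, Real.sin_arcsin (by linarith) (by linarith),
    abs_of_nonneg (by linarith), abs_of_nonneg (by linarith [Real.arcsin_le_arcsin hxy])] at h

lemma arcsin_le_pi_div_two_mul {x : ℝ} (hx : 0 ≤ x) (h1 : x ≤ 1) :
    Real.arcsin x ≤ Real.pi / 2 * x := by
  have h := Real.mul_le_sin (Real.arcsin_nonneg.2 hx) (Real.arcsin_le_pi_div_two x)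
  rw [Real.sin_arcsin (by linarith) h1] at h
  have hpi := Real.pi_pos
  calc Real.arcsin x = Real.pi / 2 * (2 / Real.pi * Real.arcsin x) := by field_simp
    _ ≤ _ := by gcongr

lemma arcsin_sub_le {x y : ℝ} (hx : 0 ≤ x) (hxy : x ≤ y) (hy : y ≤ 1 / 4) :
    Real.arcsin y - Real.arcsin x ≤ 2 * (y - x) := by
  set u := Real.arcsin x with hu
  set v := Real.arcsin y with hv
  have hux : Real.sin u = x := Real.sin_arcsin (by linarith) (by linarith)
  have hvy : Real.sin v = y := Real.sin_arcsin (by linarith) (by linarith)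
  have hu0 : 0 ≤ u := Real.arcsin_nonneg.2 hx
  have huv : u ≤ v := Real.arcsin_le_arcsin hxy
  have hpi := Real.pi_pos
  have hpi4 := Real.pi_lt_d2
  have hv1 : v ≤ 2 / 5 := by
    have := arcsin_le_pi_div_two_mul (x := y) (by linarith) (by linarith)
    nlinarith
  have h1 : y - x = 2 * Real.sin ((v - u) / 2) * Real.cos ((v + u) / 2) := by
    rw [← hux, ← hvy, Real.sin_sub_sin]
  have h2 : 2 / Real.pi * ((v - u) / 2) ≤ Real.sin ((v - u) / 2) :=
    Real.mul_le_sin (by linarith) (by linarith [Real.pi_gt_three])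
  have h3 : (9 / 10 : ℝ) ≤ Real.cos ((v + u) / 2) := by
    have := Real.one_sub_sq_div_two_le_cos (x := (v + u) / 2)
    nlinarith
  have h4 : 5 / 8 * ((v - u) / 2) ≤ 2 / Real.pi * ((v - u) / 2) := by
    apply mul_le_mul_of_nonneg_right _ (by linarith)
    rw [div_le_div_iff₀ (by norm_num) hpi]
    linarith
  have h5 : 5 / 8 * ((v - u) / 2) * (9 / 10) ≤ Real.sin ((v - u) / 2) * Real.cos ((v + u) / 2) :=
    mul_le_mul (h4.trans h2) h3 (by norm_num) (by have : 0 ≤ 5 / 8 * ((v - u) / 2) := by linarith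
                                                  linarith)
  rw [h1]
  nlinarith

/-- On the first quadrant `sin² y - sin² x = sin (y - x) sin (y + x)` is at least `sin² (y - x)`. The
bound does not degenerate at `0` and `π / 2`, where the derivative of `sin²` vanishes. -/
lemma sin_sq_sub_sin_sq_ge {x y : ℝ} (hx : 0 ≤ x) (hxy : x ≤ y) (hy : y ≤ Real.pi / 2) :
    (2 / Real.pi * (y - x)) ^ 2 ≤ Real.sin y ^ 2 - Real.sin x ^ 2 := by
  have hpi := Real.pi_pos
  have h1 : Real.sin y ^ 2 - Real.sin x ^ 2 = Real.sin (y - x) * Real.sin (y + x) := by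
    rw [Real.sin_sub, Real.sin_add]
    have e1 : Real.cos x ^ 2 = 1 - Real.sin x ^ 2 := Real.cos_sq' x
    have e2 : Real.cos y ^ 2 = 1 - Real.sin y ^ 2 := Real.cos_sq' y
    ring_nf
    rw [e1, e2]; ring
  have h2 : 2 / Real.pi * (y - x) ≤ Real.sin (y - x) := Real.mul_le_sin (by linarith) (by linarith)
  have h3 : Real.sin (y - x) ≤ Real.sin (y + x) := by
    have hs := Real.sin_nonneg_of_nonneg_of_le_pi hx (by linarith)
    have hc := Real.cos_nonneg_of_neg_pi_div_two_le_of_le (x := y) (by linarith) hy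
    rw [Real.sin_sub, Real.sin_add]
    nlinarith [mul_nonneg hc hs]
  have h0 : 0 ≤ 2 / Real.pi * (y - x) := mul_nonneg (by positivity) (by linarith)
  rw [h1, sq]
  exact mul_le_mul h2 (h2.trans h3) h0 (h0.trans h2)

/-- Probability that a measured bit equals `up`, if it is `1` with probability `p`. -/
def bitProb (up : Bool) (p : ℝ) : ℝ := if up then p else 1 - p

/-- A shift by `m` quadrants exchanges `sin²` and `cos²` when `m` is odd. -/
lemma sin_sq_sub_quadrant (m : ℕ) (x : ℝ) :
    Real.sin (x - m * (Real.pi / 2)) ^ 2 = bitProb (m % 2 = 0) (Real.sin x ^ 2) := by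
  induction m with
  | zero => simp [bitProb]
  | succ m ih =>
    have : x - ((m + 1 : ℕ) : ℝ) * (Real.pi / 2) = (x - m * (Real.pi / 2)) - Real.pi / 2 := by
      push_cast; ring
    rw [this, Real.sin_sub_pi_div_two, neg_sq, Real.cos_sq', ih]
    rcases Nat.mod_two_eq_zero_or_one m with h | h <;> simp [bitProb, h, Nat.add_mod]

/-- A lower bound for half the difference of the hit probabilities on the outer thirds of an
interval; only its positivity matters. -/
def gap : ℝ := 1 / 2 ^ 18

lemma gap_pos : 0 < gap := by unfold gap; positivity

/-- An interval of length `w` of square-root amplitudes `s` can be probed with `O(1/w)` queries: for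
a suitable number of Grover iterations and a suitable scaling `κ` of the amplitude, the rotation
angle stays in one quadrant, so that the hit probability is monotone in `s`, and the outer thirds
of the interval have hit probabilities at a constant distance. -/
lemma exists_probe {lo hi : ℝ} (h0 : 0 ≤ lo) (hlt : lo < hi) (h1 : hi ≤ 1) :
    ∃ (k : ℕ) (κ : ℝ) (up : Bool) (τ : ℝ), 0 ≤ κ ∧ κ ≤ 1 ∧ (2 * k + 1 : ℝ) ≤ 2 / (hi - lo) ∧
      (∀ s, lo ≤ s → s ≤ lo + (hi - lo) / 3 → bitProb up (hitProb ((κ * s) ^ 2) k) ≤ τ - gap) ∧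
      (∀ s, hi - (hi - lo) / 3 ≤ s → s ≤ hi →
        τ + gap ≤ bitProb up (hitProb ((κ * s) ^ 2) k)) := by
  set w := hi - lo with hw
  have hw0 : 0 < w := by linarith
  have hpi := Real.pi_pos
  have hpi3 := Real.pi_gt_three
  have hpi4 := Real.pi_lt_d2
  -- the number of iterations makes the phase vary by a constant over the interval
  obtain ⟨k, hk1, hk2⟩ : ∃ k : ℕ, (2 * k + 1 : ℝ) * w ≤ 2 ∧ 1 / 2 ≤ (2 * k + 1 : ℝ) * w := by
    refine ⟨⌊1 / (2 * w)⌋₊, ?_, ?_⟩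
    · have := Nat.floor_le (a := 1 / (2 * w)) (by positivity)
      have h2 : (⌊1 / (2 * w)⌋₊ : ℝ) * (2 * w) ≤ 1 := by
        calc _ ≤ 1 / (2 * w) * (2 * w) := by gcongr
          _ = 1 := by field_simp
      nlinarith
    · have := Nat.lt_floor_add_one (1 / (2 * w))
      have h2 : 1 < ((⌊1 / (2 * w)⌋₊ : ℝ) + 1) * (2 * w) := by
        calc 1 = 1 / (2 * w) * (2 * w) := by field_simp
          _ < _ := by gcongr
      have h3 : 0 ≤ (⌊1 / (2 * w)⌋₊ : ℝ) * w := by positivity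
      rcases le_total (1 / 2) w with h | h <;> nlinarith
  set K : ℝ := 2 * k + 1 with hK
  have hK0 : 0 < K := by positivity
  -- The scaling is chosen so that the angles of the interval lie in the `m`-th quadrant. If `K * hi`
  -- is small, this is the first quadrant. Otherwise the angle of `hi` moves by at least `π / 2` as `κ`
  -- runs through `[1/8, 1/4]`, so that it meets the upper end of some quadrant.
  obtain ⟨κ, m, hκ0, hκ1, hm1, hm2⟩ : ∃ (κ : ℝ) (m : ℕ), 1 / 16 ≤ κ ∧ κ ≤ 1 / 4 ∧
      m * (Real.pi / 2) ≤ K * Real.arcsin (κ * lo) ∧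
      K * Real.arcsin (κ * hi) ≤ (m + 1) * (Real.pi / 2) := by
    rcases lt_or_ge (K * hi) 16 with h | h
    · refine ⟨1 / 16, 0, le_refl _, by norm_num, ?_, ?_⟩
      · have := Real.arcsin_nonneg.2 (show 0 ≤ 1 / 16 * lo by linarith)
        simp only [Nat.cast_zero, zero_mul]
        positivity
      · have := arcsin_le_pi_div_two_mul (x := 1 / 16 * hi) (by linarith) (by linarith)
        calc K * Real.arcsin (1 / 16 * hi) ≤ K * (Real.pi / 2 * (1 / 16 * hi)) := by gcongr
          _ = Real.pi / 2 * (K * hi / 16) := by ring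
          _ ≤ Real.pi / 2 * 1 := by gcongr; linarith
          _ = _ := by push_cast; ring
    · set F : ℝ → ℝ := fun κ => K * Real.arcsin (κ * hi) with hF
      have hFc : ContinuousOn F (Set.Icc (1 / 8) (1 / 4)) := by
        apply Continuous.continuousOn
        exact continuous_const.mul (Real.continuous_arcsin.comp (continuous_id.mul continuous_const))
      have hgrow : F (1 / 8) + Real.pi / 2 ≤ F (1 / 4) := by
        have := sub_le_arcsin_sub (x := 1 / 8 * hi) (y := 1 / 4 * hi) (by linarith) (by linarith)
          (by linarith)
        simp only [hF]
        nlinarith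
      have hF0 : 0 < F (1 / 8) := by
        have := Real.arcsin_pos.2 (show 0 < 1 / 8 * hi by linarith)
        simp only [hF]; positivity
      set m' := ⌈F (1 / 8) / (Real.pi / 2)⌉₊ with hm'
      have hc1 : F (1 / 8) ≤ m' * (Real.pi / 2) := by
        have := Nat.le_ceil (F (1 / 8) / (Real.pi / 2))
        rwa [div_le_iff₀ (by positivity)] at this
      have hc2 : m' * (Real.pi / 2) ≤ F (1 / 4) := by
        have := (Nat.ceil_lt_add_one (a := F (1 / 8) / (Real.pi / 2)) (by positivity)).le
        rw [← hm'] at this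
        have h3 : m' * (Real.pi / 2) ≤ (F (1 / 8) / (Real.pi / 2) + 1) * (Real.pi / 2) := by gcongr
        have h4 : (F (1 / 8) / (Real.pi / 2) + 1) * (Real.pi / 2) = F (1 / 8) + Real.pi / 2 := by
          field_simp
        linarith
      obtain ⟨κ, ⟨hκ1, hκ2⟩, hκ⟩ := intermediate_value_Icc (by norm_num) hFc ⟨hc1, hc2⟩
      have hm0 : 1 ≤ m' := Nat.one_le_ceil_iff.2 (by positivity)
      refine ⟨κ, m' - 1, by linarith, hκ2, ?_, ?_⟩
      · have e : ((m' - 1 : ℕ) : ℝ) = m' - 1 := by push_cast [hm0]; ring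
        rw [e]
        have := arcsin_sub_le (x := κ * lo) (y := κ * hi) (by positivity) (by gcongr)
          (by nlinarith)
        have h5 : κ * (K * w) ≤ 1 / 4 * 2 := by gcongr
        have h6 : K * (Real.arcsin (κ * hi) - Real.arcsin (κ * lo)) ≤
            K * (2 * (κ * hi - κ * lo)) := by gcongr
        have h7 : K * Real.arcsin (κ * hi) = m' * (Real.pi / 2) := hκ
        have h8 : K * (2 * (κ * hi - κ * lo)) = 2 * (κ * (K * w)) := by rw [hw]; ring
        nlinarith
      · have e : ((m' - 1 : ℕ) : ℝ) = m' - 1 := by push_cast [hm0]; ring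
        rw [e]
        have h7 : K * Real.arcsin (κ * hi) = m' * (Real.pi / 2) := hκ
        linarith
  set ψ : ℝ → ℝ := fun s => K * Real.arcsin (κ * s) - m * (Real.pi / 2) with hψ
  have hmono : ∀ s t, s ≤ t → ψ s ≤ ψ t := by
    intro s t hst
    have := Real.arcsin_le_arcsin (show κ * s ≤ κ * t by gcongr)
    simp only [hψ]
    gcongr
  have hψlo : 0 ≤ ψ lo := by simp only [hψ]; linarith
  have hψhi : ψ hi ≤ Real.pi / 2 := by simp only [hψ]; linarith
  have hP : ∀ s, 0 ≤ s → bitProb (m % 2 = 0) (hitProb ((κ * s) ^ 2) k) = Real.sin (ψ s) ^ 2 := by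
    intro s hs
    rw [hitProb, Real.sqrt_sq (by positivity), ← sin_sq_sub_quadrant]
  have hsq : ∀ x y, 0 ≤ x → x ≤ y → y ≤ Real.pi / 2 → Real.sin x ^ 2 ≤ Real.sin y ^ 2 := by
    intro x y hx hxy hy
    have := sin_sq_sub_sin_sq_ge hx hxy hy
    nlinarith [sq_nonneg (2 / Real.pi * (y - x))]
  set u := lo + w / 3 with hu
  set v := hi - w / 3 with hv
  have huv : v - u = w / 3 := by rw [hu, hv, hw]; ring
  have hgap : 2 * gap ≤ Real.sin (ψ v) ^ 2 - Real.sin (ψ u) ^ 2 := by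
    have h2 := sin_sq_sub_sin_sq_ge (x := ψ u) (y := ψ v)
      (hψlo.trans (hmono _ _ (by linarith))) (hmono _ _ (by linarith))
      ((hmono _ _ (by linarith)).trans hψhi)
    have h3 : (1 : ℝ) / 96 ≤ ψ v - ψ u := by
      have h4 := sub_le_arcsin_sub (x := κ * u) (y := κ * v)
        (mul_nonneg (by linarith) (by linarith)) (by gcongr; linarith) (by nlinarith)
      have h5 : ψ v - ψ u = K * (Real.arcsin (κ * v) - Real.arcsin (κ * u)) := by
        simp only [hψ]; ring
      have h6 : K * (κ * v - κ * u) = κ * (K * w) / 3 := by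
        rw [← mul_sub, huv]; ring
      have h7 : 1 / 16 * (1 / 2) ≤ κ * (K * w) := by gcongr
      rw [h5]
      nlinarith
    have h9 : (1 / 2 : ℝ) * (1 / 96) ≤ 2 / Real.pi * (ψ v - ψ u) := by
      have : (1 / 2 : ℝ) ≤ 2 / Real.pi := by
        rw [div_le_div_iff₀ (by norm_num) hpi]; linarith
      gcongr
    have h10 : ((1 / 2 : ℝ) * (1 / 96)) ^ 2 ≤ (2 / Real.pi * (ψ v - ψ u)) ^ 2 := by gcongr
    have h11 : 2 * gap ≤ ((1 / 2 : ℝ) * (1 / 96)) ^ 2 := by norm_num [gap]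
    linarith
  refine ⟨k, κ, m % 2 = 0, (Real.sin (ψ u) ^ 2 + Real.sin (ψ v) ^ 2) / 2, by linarith, by linarith,
    by rwa [le_div_iff₀ hw0], ?_, ?_⟩
  · intro s hs1 hs2
    have h2 := hsq (ψ s) (ψ u) (hψlo.trans (hmono _ _ hs1)) (hmono _ _ hs2)
      ((hmono _ _ (by linarith)).trans hψhi)
    rw [hP s (by linarith)]
    linarith
  · intro s hs1 hs2
    have h2 := hsq (ψ v) (ψ s) (hψlo.trans (hmono _ _ (by linarith))) (hmono _ _ hs1)
      ((hmono _ _ hs2).trans hψhi)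
    rw [hP s (by linarith)]
    linarith

/-- A centered Bernoulli variable is sub-Gaussian near `0`. -/
lemma bernoulli_mgf_le {q t : ℝ} (h0 : 0 ≤ q) (h1 : q ≤ 1) (ht : |t| ≤ 1) :
    q * Real.exp (t * (1 - q)) + (1 - q) * Real.exp (-(t * q)) ≤ Real.exp (t ^ 2) := by
  have key : ∀ x : ℝ, |x| ≤ 1 → Real.exp x ≤ 1 + x + x ^ 2 := by
    intro x hx
    have := (abs_le.1 (Real.abs_exp_sub_one_sub_id_le hx)).2
    linarith
  have e1 := key (t * (1 - q)) (by
    rw [abs_mul, abs_of_nonneg (by linarith : 0 ≤ 1 - q)]; nlinarith [abs_nonneg t])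
  have e2 := key (-(t * q)) (by
    rw [abs_neg, abs_mul, abs_of_nonneg h0]; nlinarith [abs_nonneg t])
  have e3 := Real.add_one_le_exp (t ^ 2)
  have h3 := mul_le_mul_of_nonneg_left e1 h0
  have h4 := mul_le_mul_of_nonneg_left e2 (by linarith : 0 ≤ 1 - q)
  have h5 : 0 ≤ t ^ 2 := sq_nonneg t
  have h6 : q * (1 - q) ≤ 1 := by nlinarith
  nlinarith [mul_le_mul_of_nonneg_left h6 h5]

namespace Proc

variable {d : ℕ}

/-- Run the same circuit `N` times and count the bits equal to `up`. -/
def shots (Y : Payload d) (k : ℕ) (up : Bool) : ℕ → Proc d ℕ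
  | 0 => .ret 0
  | N + 1 => .run Y k fun b => (shots Y k up N).map fun c => c + if b = up then 1 else 0

lemma queries_shots (Y : Payload d) (k : ℕ) (up : Bool) (N : ℕ) :
    (shots Y k up N).queries = N * (2 * k + 1) := by
  induction N with
  | zero => simp [shots, queries]
  | succ N ih => simp only [shots, queries, queries_map, ih, max_self]; ring

variable (a : Payload d → ℝ)

/-- The moment generating function of the centered count is at most the `N`-th power of the bound for
a single bit. -/
lemma expect_shots_exp_le (Y : Payload d) (k : ℕ) (up : Bool) (N : ℕ) {t : ℝ} (ht : |t| ≤ 1) :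
    ((shots Y k up N).expect a fun c : ℕ =>
      Real.exp (t * (c - N * bitProb up (hitProb (a Y) k)))) ≤ Real.exp (t ^ 2 * N) := by
  set q := bitProb up (hitProb (a Y) k) with hq
  have hp0 := hitProb_nonneg (a Y) k
  have hp1 := hitProb_le_one (a Y) k
  have hq0 : 0 ≤ q := by rw [hq]; unfold bitProb; split_ifs <;> linarith
  have hq1 : q ≤ 1 := by rw [hq]; unfold bitProb; split_ifs <;> linarith
  induction N with
  | zero => simp [shots, expect]
  | succ N ih =>
    have e1 : ∀ c : ℕ, Real.exp (t * (((c + 1 : ℕ) : ℝ) - ((N + 1 : ℕ) : ℝ) * q)) =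
        Real.exp (t * (1 - q)) * Real.exp (t * (c - N * q)) := by
      intro c; rw [← Real.exp_add]; congr 1; push_cast; ring
    have e2 : ∀ c : ℕ, Real.exp (t * (((c + 0 : ℕ) : ℝ) - ((N + 1 : ℕ) : ℝ) * q)) =
        Real.exp (-(t * q)) * Real.exp (t * (c - N * q)) := by
      intro c; rw [← Real.exp_add]; congr 1; push_cast; ring
    have hE : 0 ≤ (shots Y k up N).expect a fun c : ℕ => Real.exp (t * (c - N * q)) :=
      expect_nonneg _ _ fun c => (Real.exp_pos _).le
    have e3 : ((shots Y k up (N + 1)).expect a fun c : ℕ =>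
        Real.exp (t * (c - ((N + 1 : ℕ) : ℝ) * q))) =
        (q * Real.exp (t * (1 - q)) + (1 - q) * Real.exp (-(t * q))) *
        (shots Y k up N).expect a fun c : ℕ => Real.exp (t * (c - N * q)) := by
      simp only [shots, expect, expect_map]
      cases up
      · simp only [Bool.true_eq_false, if_false, if_true, e1, e2, expect_const_mul]
        have : q = 1 - hitProb (a Y) k := by rw [hq]; rfl
        rw [this]; ring
      · simp only [Bool.false_eq_true, if_false, if_true, e1, e2, expect_const_mul]
        have : q = hitProb (a Y) k := by rw [hq]; rfl
        rw [this]; ring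
    rw [e3]
    calc _ ≤ Real.exp (t ^ 2) * Real.exp (t ^ 2 * N) := by
          gcongr
          exact bernoulli_mgf_le hq0 hq1 ht
      _ = _ := by rw [← Real.exp_add]; congr 1; push_cast; ring

/-- Chernoff bound for the upper tail of the count. -/
lemma shots_ge_le (Y : Payload d) (k : ℕ) (up : Bool) (N : ℕ) {τ γ : ℝ} (hγ0 : 0 ≤ γ)
    (hγ : γ ≤ 1) (h : bitProb up (hitProb (a Y) k) ≤ τ - γ) :
    ((shots Y k up N).expect a fun c : ℕ => if τ * N ≤ c then 1 else 0) ≤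
      Real.exp (-(γ ^ 2 / 4 * N)) := by
  set q := bitProb up (hitProb (a Y) k) with hq
  have h1 := expect_shots_exp_le a Y k up N (t := γ / 2) (by rw [abs_of_nonneg] <;> linarith)
  have h2 : ((shots Y k up N).expect a fun c : ℕ => if τ * N ≤ c then 1 else 0) ≤
      (shots Y k up N).expect a fun c : ℕ => Real.exp (-(γ / 2 * (γ * N))) *
        Real.exp (γ / 2 * (c - N * q)) := by
    apply expect_mono
    intro c
    split_ifs with hc
    · rw [← Real.exp_add]
      apply Real.one_le_exp
      have : γ * N ≤ c - N * q := by nlinarith [(Nat.cast_nonneg N : (0 : ℝ) ≤ N)]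
      nlinarith
    · positivity
  rw [expect_const_mul] at h2
  refine h2.trans ((mul_le_mul_of_nonneg_left h1 (Real.exp_pos _).le).trans (le_of_eq ?_))
  rw [← Real.exp_add]; congr 1; ring

/-- Chernoff bound for the lower tail of the count. -/
lemma shots_lt_le (Y : Payload d) (k : ℕ) (up : Bool) (N : ℕ) {τ γ : ℝ} (hγ0 : 0 ≤ γ)
    (hγ : γ ≤ 1) (h : τ + γ ≤ bitProb up (hitProb (a Y) k)) :
    ((shots Y k up N).expect a fun c : ℕ => if τ * N ≤ c then 0 else 1) ≤
      Real.exp (-(γ ^ 2 / 4 * N)) := by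
  set q := bitProb up (hitProb (a Y) k) with hq
  have h1 := expect_shots_exp_le a Y k up N (t := -(γ / 2))
    (by rw [abs_neg, abs_of_nonneg] <;> linarith)
  have h2 : ((shots Y k up N).expect a fun c : ℕ => if τ * N ≤ c then 0 else 1) ≤
      (shots Y k up N).expect a fun c : ℕ => Real.exp (-(γ / 2 * (γ * N))) *
        Real.exp (-(γ / 2) * (c - N * q)) := by
    apply expect_mono
    intro c
    split_ifs with hc
    · positivity
    · rw [← Real.exp_add]
      apply Real.one_le_exp
      have : γ * N ≤ N * q - c := by nlinarith [(Nat.cast_nonneg N : (0 : ℝ) ≤ N)]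
      nlinarith
  rw [expect_const_mul] at h2
  refine h2.trans ((mul_le_mul_of_nonneg_left h1 (Real.exp_pos _).le).trans (le_of_eq ?_))
  rw [← Real.exp_add]; congr 1; ring

end Proc

/-- The payload `c Y`. -/
def scalePayload {d : ℕ} (c : unitInterval) (Y : Payload d) : Payload d := fun r => c * Y r

lemma markedWeight_scalePayload {n d : ℕ} (O : ScenarioOracle n d) (w : EuclideanSpace ℝ (Fin d))
    (z : ℝ) (c : unitInterval) (Y : Payload d) :
    markedWeight O w z (scalePayload c Y) = c * markedWeight O w z Y := by
  simp only [markedWeight, scalePayload, Finset.mul_sum, Set.Icc.coe_mul]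
  exact Finset.sum_congr rfl fun i _ => by ring

/-- Noisy ternary search for the square root of an amplitude. With `J` steps left, a step takes a
number of shots proportional to `J`, so that early steps, whose failure costs more accuracy, fail
with exponentially smaller probability. The cost `12 (3/2)^J - 4 J - 12` is a supersolution of the
recursion `c (J + 1) = 2 (J + 1) + 3/2 c J`. The outputs stay in the initial interval, which bounds
the error of a failing step. -/
lemma exists_search : ∃ N₀ : ℕ, ∀ (d : ℕ) (Y : Payload d) (J : ℕ) (lo hi : ℝ), 0 ≤ lo → lo < hi →
    hi ≤ 1 → ∃ x : Proc d ℝ,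
      (x.queries : ℝ) ≤ N₀ * (12 * (3 / 2) ^ J - 4 * J - 12) / (hi - lo) ∧
      (∀ (a : Payload d → ℝ) (f : ℝ → ℝ) (B : ℝ), (∀ v, lo ≤ v → v ≤ hi → f v ≤ B) →
        x.expect a f ≤ B) ∧
      ∀ (n : ℕ) (O : ScenarioOracle n d) (w : EuclideanSpace ℝ (Fin d)) (z s : ℝ),
        lo ≤ s → s ≤ hi → markedWeight O w z Y = s ^ 2 →
        (x.expect (markedWeight O w z) fun v => (v - s) ^ 4) ≤
          (2 - (1 / 2) ^ J) * ((hi - lo) * (2 / 3) ^ J) ^ 4 := by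
  -- a step fails with probability at most `(8/81) ^ (J+1)`, which is `(1/2) ^ (J+1)` times the fourth
  -- power of the factor `(2/3) ^ (J+1)` by which the interval still has to shrink
  obtain ⟨N₀, hN₀⟩ : ∃ N₀ : ℕ, Real.exp (-(gap ^ 2 / 4 * N₀)) ≤ 8 / 81 := by
    obtain ⟨N₀, h⟩ := exists_nat_ge (Real.log (81 / 8) / (gap ^ 2 / 4))
    refine ⟨N₀, ?_⟩
    have hg := gap_pos
    rw [div_le_iff₀ (by positivity)] at h
    calc Real.exp (-(gap ^ 2 / 4 * N₀)) ≤ Real.exp (-Real.log (81 / 8)) := by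
          apply Real.exp_le_exp.2; linarith
      _ = 8 / 81 := by rw [Real.exp_neg, Real.exp_log (by norm_num)]; norm_num
  refine ⟨N₀, fun d Y J => ?_⟩
  induction J with
  | zero =>
    intro lo hi h0 hlt h1
    refine ⟨.ret lo, by simp [Proc.queries], fun a f B h => h lo le_rfl hlt.le, ?_⟩
    intro n O w z s hs1 hs2 _
    simp only [Proc.expect, pow_zero, mul_one]
    have : (lo - s) ^ 4 ≤ (hi - lo) ^ 4 := by
      rw [show (lo - s) ^ 4 = (s - lo) ^ 4 by ring]
      exact pow_le_pow_left₀ (by linarith) (by linarith) 4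
    linarith
  | succ J ih =>
    intro lo hi h0 hlt h1
    set W := hi - lo with hW
    have hW0 : 0 < W := by linarith
    obtain ⟨k, κ, up, τ, hκ0, hκ1, hk, hlow, hhigh⟩ := exists_probe h0 hlt h1
    obtain ⟨x₁, hq₁, hb₁, he₁⟩ := ih lo (hi - W / 3) h0 (by linarith) (by linarith)
    obtain ⟨x₂, hq₂, hb₂, he₂⟩ := ih (lo + W / 3) hi (by linarith) (by linarith) h1
    have hw₁ : hi - W / 3 - lo = 2 / 3 * W := by rw [hW]; ring
    have hw₂ : hi - (lo + W / 3) = 2 / 3 * W := by rw [hW]; ring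
    rw [hw₁] at hq₁ he₁
    rw [hw₂] at hq₂ he₂
    set N := N₀ * (J + 1) with hN
    have hκ : κ ^ 2 ∈ unitInterval := ⟨sq_nonneg κ, pow_le_one₀ hκ0 hκ1⟩
    set Y' := scalePayload ⟨κ ^ 2, hκ⟩ Y with hY'
    set Q : ℝ := N₀ * (12 * (3 / 2) ^ J - 4 * J - 12) / (2 / 3 * W) with hQ
    refine ⟨(Proc.shots Y' k up N).bind fun c => if τ * N ≤ (c : ℝ) then x₂ else x₁, ?_, ?_, ?_⟩
    · have h2 := Proc.queries_bind_le (Proc.shots Y' k up N)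
        (fun c => if τ * N ≤ (c : ℝ) then x₂ else x₁) (max x₁.queries x₂.queries)
        (fun c => by split_ifs; exacts [le_max_right _ _, le_max_left _ _])
      rw [Proc.queries_shots] at h2
      have h3 : ((max x₁.queries x₂.queries : ℕ) : ℝ) ≤ Q := by
        rw [Nat.cast_max]; exact max_le hq₁ hq₂
      have h4 : ((N * (2 * k + 1) : ℕ) : ℝ) ≤ N * (2 / W) := by push_cast; gcongr
      calc _ ≤ ((N * (2 * k + 1) + max x₁.queries x₂.queries : ℕ) : ℝ) := by exact_mod_cast h2
        _ ≤ N * (2 / W) + Q := by rw [Nat.cast_add]; exact add_le_add h4 h3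
        _ ≤ _ := by
          rw [hQ, hN]
          have e : ((N₀ * (J + 1) : ℕ) : ℝ) * (2 / W) +
              N₀ * (12 * (3 / 2) ^ J - 4 * J - 12) / (2 / 3 * W) =
              N₀ * (2 * (J + 1) + 3 / 2 * (12 * (3 / 2) ^ J - 4 * J - 12)) / W := by
            push_cast; field_simp
          rw [e]
          gcongr
          push_cast
          rw [pow_succ]
          linarith [(Nat.cast_nonneg J : (0 : ℝ) ≤ J)]
    · intro a f B h
      rw [Proc.expect_bind]
      calc _ ≤ (Proc.shots Y' k up N).expect a fun _ => B := by
            apply Proc.expect_mono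
            intro c
            split_ifs
            · exact hb₂ a f B fun v hv1 hv2 => h v (by linarith) hv2
            · exact hb₁ a f B fun v hv1 hv2 => h v hv1 (by linarith)
        _ = B := Proc.expect_const _ _ _
    · intro n O w z s hs1 hs2 hs
      set a := markedWeight O w z with ha
      set f : ℝ → ℝ := fun v => (v - s) ^ 4 with hf
      have haY : a Y' = (κ * s) ^ 2 := by
        have : a Y' = κ ^ 2 * a Y := markedWeight_scalePayload O w z ⟨κ ^ 2, hκ⟩ Y
        rw [this, hs]; ring
      set E : ℝ := (2 - (1 / 2) ^ J) * ((2 / 3 * W) * (2 / 3) ^ J) ^ 4 with hE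
      have hpowJ : (1 / 2 : ℝ) ^ J ≤ 1 := pow_le_one₀ (by norm_num) (by norm_num)
      have hE0 : 0 ≤ E := by
        have : 0 ≤ (2 : ℝ) - (1 / 2) ^ J := by linarith
        positivity
      have hall : ∀ v, lo ≤ v → v ≤ hi → f v ≤ W ^ 4 := by
        intro v h1 h2
        simp only [hf]
        rw [← Even.pow_abs (by decide : Even 4)]
        exact pow_le_pow_left₀ (abs_nonneg _) (abs_le.2 ⟨by linarith, by linarith⟩) 4
      have hfail : Real.exp (-(gap ^ 2 / 4 * N)) ≤ (8 / 81) ^ (J + 1) := by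
        calc Real.exp (-(gap ^ 2 / 4 * N)) = Real.exp (-(gap ^ 2 / 4 * N₀)) ^ (J + 1) := by
              rw [← Real.exp_nat_mul, hN]; congr 1; push_cast; ring
          _ ≤ _ := by gcongr
      have hgap1 : gap ≤ 1 := by norm_num [gap]
      have htotal : E + (8 / 81) ^ (J + 1) * W ^ 4 =
          (2 - (1 / 2) ^ (J + 1)) * (W * (2 / 3) ^ (J + 1)) ^ 4 := by
        have e1 : ((2 / 3 * W) * (2 / 3) ^ J) ^ 4 = W ^ 4 * (16 / 81) ^ (J + 1) := by
          rw [show (16 / 81 : ℝ) = (2 / 3) ^ 4 by norm_num, ← pow_mul]; ring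
        have e2 : (W * (2 / 3) ^ (J + 1)) ^ 4 = W ^ 4 * (16 / 81) ^ (J + 1) := by
          rw [show (16 / 81 : ℝ) = (2 / 3) ^ 4 by norm_num, ← pow_mul]; ring
        have e3 : (8 / 81 : ℝ) ^ (J + 1) = (1 / 2) ^ (J + 1) * (16 / 81) ^ (J + 1) := by
          rw [← mul_pow]; norm_num
        rw [hE, e1, e2, e3, pow_succ (1 / 2 : ℝ) J]; ring
      rw [Proc.expect_bind, ← htotal]
      have hpos : 0 ≤ (8 / 81 : ℝ) ^ (J + 1) * W ^ 4 := by positivity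
      -- if `s` lies in the middle third, both outcomes of the step are right
      by_cases hA : s ≤ lo + W / 3
      · have g1 : x₁.expect a f ≤ E := he₁ n O w z s hs1 (by linarith) hs
        have g2 : x₂.expect a f ≤ W ^ 4 :=
          hb₂ a f _ fun v hv1 hv2 => hall v (by linarith) hv2
        have hp := Proc.shots_ge_le a Y' k up N gap_pos.le hgap1 (by rw [haY]; exact hlow s hs1 hA)
        calc _ ≤ (Proc.shots Y' k up N).expect a
              fun c : ℕ => E + W ^ 4 * (if τ * N ≤ (c : ℝ) then 1 else 0) := by
              apply Proc.expect_mono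
              intro c
              split_ifs
              · linarith
              · linarith
          _ = E + W ^ 4 * _ := by
              rw [Proc.expect_add, Proc.expect_const, Proc.expect_const_mul]
          _ ≤ E + W ^ 4 * (8 / 81) ^ (J + 1) := by
              gcongr
              exact hp.trans hfail
          _ = _ := by ring
      · by_cases hB : hi - W / 3 ≤ s
        · have g2 : x₂.expect a f ≤ E := he₂ n O w z s (by linarith) hs2 hs
          have g1 : x₁.expect a f ≤ W ^ 4 :=
            hb₁ a f _ fun v hv1 hv2 => hall v hv1 (by linarith)
          have hp := Proc.shots_lt_le a Y' k up N gap_pos.le hgap1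
            (by rw [haY]; exact hhigh s hB hs2)
          calc _ ≤ (Proc.shots Y' k up N).expect a
                fun c : ℕ => E + W ^ 4 * (if τ * N ≤ (c : ℝ) then 0 else 1) := by
                apply Proc.expect_mono
                intro c
                split_ifs
                · linarith
                · linarith
            _ = E + W ^ 4 * _ := by
                rw [Proc.expect_add, Proc.expect_const, Proc.expect_const_mul]
            _ ≤ E + W ^ 4 * (8 / 81) ^ (J + 1) := by
                gcongr
                exact hp.trans hfail
            _ = _ := by ring
        · have g1 : x₁.expect a f ≤ E := he₁ n O w z s hs1 (by linarith) hs
          have g2 : x₂.expect a f ≤ E := he₂ n O w z s (by linarith) hs2 hs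
          calc _ ≤ (Proc.shots Y' k up N).expect a fun _ => E := by
                apply Proc.expect_mono
                intro c
                split_ifs
                · exact g2
                · exact g1
            _ = E := Proc.expect_const _ _ _
            _ ≤ _ := by linarith

/-- Amplitude estimation with `O(M)` queries: the mean square error is of the order
`p / M² + 1 / M⁴`, without logarithmic factors. -/
lemma exists_amplitudeEstimation : ∃ C : ℝ, 0 < C ∧ ∀ (d : ℕ) (Y : Payload d) (M : ℝ), 1 ≤ M →
    ∃ x : Proc d ℝ, (x.queries : ℝ) ≤ C * M ∧
      ∀ (n : ℕ) (O : ScenarioOracle n d) (w : EuclideanSpace ℝ (Fin d)) (z : ℝ),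
        (x.expect (markedWeight O w z) fun v => (v - markedWeight O w z Y) ^ 2) ≤
          C * (markedWeight O w z Y / M ^ 2 + 1 / M ^ 4) := by
  obtain ⟨N₀, h⟩ := exists_search
  refine ⟨18 * N₀ + 12, by positivity, fun d Y M hM => ?_⟩
  obtain ⟨J, hJ1, hJ2⟩ := exists_nat_pow_near hM (by norm_num : (1 : ℝ) < 3 / 2)
  obtain ⟨x, hq, -, he⟩ := h d Y (J + 1) 0 1 le_rfl one_pos le_rfl
  have hM0 : 0 < M := by linarith
  refine ⟨x.map fun v => v ^ 2, ?_, ?_⟩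
  · rw [Proc.queries_map]
    have hN : (0 : ℝ) ≤ N₀ := Nat.cast_nonneg _
    have e : (3 / 2 : ℝ) ^ (J + 1) ≤ 3 / 2 * M := by rw [pow_succ]; linarith
    calc (x.queries : ℝ) ≤ _ := hq
      _ ≤ N₀ * (18 * M) := by
        rw [sub_zero, div_one]
        gcongr
        have : (0 : ℝ) ≤ ((J + 1 : ℕ) : ℝ) := Nat.cast_nonneg _
        linarith
      _ ≤ _ := by nlinarith
  · intro n O w z
    rw [Proc.expect_map]
    set a := markedWeight O w z with ha
    set p := a Y with hp
    have hp0 : 0 ≤ p := markedWeight_nonneg O w z Y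
    have hp1 : p ≤ 1 := markedWeight_le_one O w z Y
    set s := Real.sqrt p with hs
    have hs2 : s ^ 2 = p := Real.sq_sqrt hp0
    have h4 := he n O w z s (Real.sqrt_nonneg _) (Real.sqrt_le_one.2 hp1) hs2.symm
    have h5 : (x.expect a fun v => (v - s) ^ 4) ≤ 2 / M ^ 4 := by
      refine h4.trans ?_
      have e1 : (2 / 3 : ℝ) ^ (J + 1) ≤ 1 / M := by
        rw [show (2 / 3 : ℝ) = 1 / (3 / 2) by norm_num, one_div_pow]
        exact one_div_le_one_div_of_le hM0 hJ2.le
      have e2 : (0 : ℝ) ≤ (1 / 2) ^ (J + 1) := by positivity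
      calc _ ≤ 2 * (1 / M) ^ 4 := by
            rw [sub_zero, one_mul]
            gcongr
            linarith
        _ = _ := by rw [one_div_pow]; ring
    calc _ ≤ x.expect a fun v => 4 * p / M ^ 2 + (4 * p * M ^ 2 + 2) * (v - s) ^ 4 := by
          apply Proc.expect_mono
          intro v
          rw [← hs2]
          -- with `Δ = v - s`: `(v² - s²)² = Δ² (2s + Δ)² ≤ 8 s² Δ² + 2 Δ⁴`
          have e1 : (v ^ 2 - s ^ 2) ^ 2 ≤ 8 * s ^ 2 * (v - s) ^ 2 + 2 * (v - s) ^ 4 := by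
            nlinarith [mul_nonneg (sq_nonneg (v - s)) (sq_nonneg (2 * s - (v - s)))]
          have e2 : 2 * (v - s) ^ 2 ≤ 1 / M ^ 2 + M ^ 2 * (v - s) ^ 4 := by
            have := two_mul_le_add_sq (1 / M) (M * (v - s) ^ 2)
            have e3 : 2 * (1 / M) * (M * (v - s) ^ 2) = 2 * (v - s) ^ 2 := by field_simp
            rw [e3] at this
            calc _ ≤ _ := this
              _ = _ := by ring
          have e4 : 4 * s ^ 2 * (2 * (v - s) ^ 2) ≤
              4 * s ^ 2 * (1 / M ^ 2 + M ^ 2 * (v - s) ^ 4) := by gcongr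
          have e5 : 4 * s ^ 2 / M ^ 2 = 4 * s ^ 2 * (1 / M ^ 2) := by ring
          rw [e5]
          nlinarith
      _ = 4 * p / M ^ 2 + (4 * p * M ^ 2 + 2) * x.expect a fun v => (v - s) ^ 4 := by
          rw [Proc.expect_add, Proc.expect_const, Proc.expect_const_mul]
      _ ≤ 4 * p / M ^ 2 + (4 * p * M ^ 2 + 2) * (2 / M ^ 4) := by gcongr
      _ = 12 * (p / M ^ 2) + 4 * (1 / M ^ 4) := by field_simp; ring
      _ ≤ _ := by
          have hN : (0 : ℝ) ≤ N₀ := Nat.cast_nonneg _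
          have e1 : 0 ≤ p / M ^ 2 := by positivity
          have e2 : 0 ≤ 1 / M ^ 4 := by positivity
          nlinarith [mul_nonneg hN e1, mul_nonneg hN e2]

/-! ### Means of real functions by dyadic levels -/

section Levels

/-- Payload for the part of `y` between the thresholds `2 ^ j - 1` and `2 ^ (j + 1) - 1`, divided by
the distance `2 ^ j` of the thresholds. -/
def levelPayload {d : ℕ} (y : EuclideanSpace ℝ (Fin d) → ℝ) (j : ℕ) : Payload d :=
  fun r => Set.projIcc 0 1 zero_le_one ((y r - (2 ^ j - 1)) / 2 ^ j)

/-- `y` cut off to the interval `[0, 2 ^ J - 1]`. -/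
def truncate (J : ℕ) (y : ℝ) : ℝ := max 0 (min (2 ^ J - 1) y)

lemma sum_levelPayload {d : ℕ} (y : EuclideanSpace ℝ (Fin d) → ℝ) (J : ℕ)
    (r : EuclideanSpace ℝ (Fin d)) :
    ∑ j : Fin J, (2 : ℝ) ^ (j : ℕ) * (levelPayload y j r : ℝ) = truncate J (y r) := by
  rw [Fin.sum_univ_eq_sum_range (fun j => (2 : ℝ) ^ j * (levelPayload y j r : ℝ)) J]
  induction J with
  | zero => simp [truncate]
  | succ J ih =>
    rw [Finset.sum_range_succ, ih]
    have hA : (1 : ℝ) ≤ 2 ^ J := one_le_pow₀ (by norm_num)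
    have e : (2 : ℝ) ^ J * (levelPayload y J r : ℝ) = max 0 (min (2 ^ J) (y r - (2 ^ J - 1))) := by
      rw [levelPayload, Set.coe_projIcc, mul_max_of_nonneg _ _ (by positivity),
        mul_min_of_nonneg _ _ (by positivity), mul_zero, mul_one, mul_div_cancel₀ _ (by positivity)]
    rw [e, truncate, truncate, pow_succ]
    generalize (2 : ℝ) ^ J = A at *
    generalize y r = t
    rcases le_total t (A - 1) with h | h
    · rw [min_eq_right h, min_eq_right (show t - (A - 1) ≤ A by linarith),
        max_eq_left (show t - (A - 1) ≤ 0 by linarith),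
        min_eq_right (show t ≤ A * 2 - 1 by linarith), add_zero]
    · rw [min_eq_left h, max_eq_right (by linarith)]
      rcases le_total t (A * 2 - 1) with h' | h'
      · rw [min_eq_right (by linarith), min_eq_right h', max_eq_right (by linarith),
          max_eq_right (by linarith)]
        ring
      · rw [min_eq_left (by linarith), min_eq_left h', max_eq_right (by linarith),
          max_eq_right (by linarith)]
        ring

/-- Markov's inequality for the tenth power, pointwise: `1024 ^ j` is `2 ^ (10 j)`. -/
lemma levelPayload_le {d : ℕ} (y : EuclideanSpace ℝ (Fin d) → ℝ) (j : ℕ)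
    (r : EuclideanSpace ℝ (Fin d)) :
    (levelPayload y j r : ℝ) ≤ (1 + |y r|) ^ 10 / 1024 ^ j := by
  have hA : (1 : ℝ) ≤ 2 ^ j := one_le_pow₀ (by norm_num)
  have e : (1024 : ℝ) ^ j = (2 ^ j) ^ 10 := by
    rw [← pow_mul, mul_comm, pow_mul]; norm_num
  rw [e, ← div_pow, levelPayload, Set.coe_projIcc]
  rcases le_total (y r) (2 ^ j - 1) with h | h
  · have : (y r - (2 ^ j - 1)) / 2 ^ j ≤ 0 := div_nonpos_of_nonpos_of_nonneg (by linarith) (by positivity)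
    rw [max_eq_left ((min_le_right _ _).trans this)]
    positivity
  · refine (max_le zero_le_one (min_le_left _ _)).trans (one_le_pow₀ ?_)
    rw [one_le_div (by positivity)]
    linarith [le_abs_self (y r)]

lemma sq_sub_truncate_le (J : ℕ) (y : ℝ) :
    (y - (truncate J y - truncate J (-y))) ^ 2 ≤ (1 + |y|) ^ 10 / 256 ^ J := by
  have hA : (1 : ℝ) ≤ 2 ^ J := one_le_pow₀ (by norm_num)
  have e : (256 : ℝ) ^ J = (2 ^ J) ^ 8 := by
    rw [← pow_mul, mul_comm, pow_mul]; norm_num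
  have e2 : (y - (truncate J y - truncate J (-y))) ^ 2 = (max 0 (|y| - (2 ^ J - 1))) ^ 2 := by
    unfold truncate
    generalize (2 : ℝ) ^ J = A at *
    rcases le_total 0 y with h0 | h0
    · rw [abs_of_nonneg h0, min_eq_right (show -y ≤ A - 1 by linarith),
        max_eq_left (show -y ≤ 0 by linarith)]
      rcases le_total y (A - 1) with h | h
      · rw [min_eq_right h, max_eq_right h0, max_eq_left (by linarith)]; ring
      · rw [min_eq_left h, max_eq_right (by linarith), max_eq_right (by linarith)]; ring
    · rw [abs_of_nonpos h0, min_eq_right (show y ≤ A - 1 by linarith),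
        max_eq_left (show y ≤ 0 by linarith)]
      rcases le_total (-y) (A - 1) with h | h
      · rw [min_eq_right h, max_eq_right (by linarith), max_eq_left (by linarith)]; ring
      · rw [min_eq_left h, max_eq_right (by linarith), max_eq_right (by linarith)]; ring
  rw [e2, e]
  rcases le_total (|y|) (2 ^ J - 1) with h | h
  · rw [max_eq_left (by linarith), zero_pow two_ne_zero]
    positivity
  · rw [max_eq_right (by linarith), le_div_iff₀ (by positivity)]
    have h1 : (|y| - (2 ^ J - 1)) ^ 2 ≤ (1 + |y|) ^ 2 :=
      pow_le_pow_left₀ (by linarith) (by linarith) 2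
    have h2 : ((2 : ℝ) ^ J) ^ 8 ≤ (1 + |y|) ^ 8 := pow_le_pow_left₀ (by linarith) (by linarith) 8
    calc _ ≤ (1 + |y|) ^ 2 * (1 + |y|) ^ 8 := mul_le_mul h1 h2 (by positivity) (by positivity)
      _ = _ := by ring

lemma sum_half_pow_le (J : ℕ) : ∑ j : Fin J, (1 / 2 : ℝ) ^ (j : ℕ) ≤ 2 := by
  rw [Fin.sum_univ_eq_sum_range (fun j => (1 / 2 : ℝ) ^ j) J]
  exact sum_geometric_two_le J

end Levels

section Tail

variable {n d : ℕ} (O : ScenarioOracle n d) (w : EuclideanSpace ℝ (Fin d)) (z : ℝ)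

lemma tailWeight_nonneg (i : Bits n) : 0 ≤ tailWeight O w z i := by
  unfold tailWeight
  split_ifs
  exacts [O.p_nonneg i, le_rfl]

lemma sum_tailWeight_le_one : ∑ i, tailWeight O w z i ≤ 1 := by
  rw [← O.p_sum]
  refine Finset.sum_le_sum fun i _ => ?_
  unfold tailWeight
  split_ifs
  exacts [le_rfl, O.p_nonneg i]

/-- The tenth moment of `1 + |y|` on the tail. For `M = 16 ^ J`, it bounds both the bias of truncation
at `2 ^ J` by a multiple of `1 / M`, which takes an eighth moment above the second one, and the
amplitudes of the levels. -/
def tailMoment (y : EuclideanSpace ℝ (Fin d) → ℝ) : ℝ :=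
  ∑ i, tailWeight O w z i * (1 + |y (O.ret i)|) ^ 10

lemma tailMoment_nonneg (y : EuclideanSpace ℝ (Fin d) → ℝ) : 0 ≤ tailMoment O w z y :=
  Finset.sum_nonneg fun i _ => mul_nonneg (tailWeight_nonneg O w z i) (by positivity)

/-- The Cauchy-Schwarz inequality for the sub-probability weights of the tail. -/
lemma sq_sum_tailWeight_le (f : Bits n → ℝ) :
    (∑ i, tailWeight O w z i * f i) ^ 2 ≤ ∑ i, tailWeight O w z i * f i ^ 2 := by
  have h := Finset.sum_sq_le_sum_mul_sum_of_sq_le_mul Finset.univ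
    (r := fun i => tailWeight O w z i * f i) (f := tailWeight O w z)
    (g := fun i => tailWeight O w z i * f i ^ 2) (fun i _ => tailWeight_nonneg O w z i)
    (fun i _ => mul_nonneg (tailWeight_nonneg O w z i) (sq_nonneg _)) (fun i _ => le_of_eq (by ring))
  refine h.trans (mul_le_of_le_one_left ?_ (sum_tailWeight_le_one O w z))
  exact Finset.sum_nonneg fun i _ => mul_nonneg (tailWeight_nonneg O w z i) (sq_nonneg _)

end Tail

/-- Estimation of the truncated mean of a real function. Level `j` has amplitudes of tail weight
`O(2 ^ (-10 j))`, and is therefore estimated with `2 ^ j` times fewer queries than level `0`. Here `M = 16 ^ J`, and `256 ^ J`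
is `M²`. -/
lemma exists_truncatedMean : ∃ C : ℝ, 0 < C ∧ ∀ (d : ℕ) (y : EuclideanSpace ℝ (Fin d) → ℝ) (J : ℕ),
    ∃ x : Proc d ℝ, (x.queries : ℝ) ≤ C * 16 ^ J ∧
      ∀ (n : ℕ) (O : ScenarioOracle n d) (w : EuclideanSpace ℝ (Fin d)) (z : ℝ),
        (x.expect (markedWeight O w z) fun v =>
          (v - ∑ i, tailWeight O w z i * truncate J (y (O.ret i))) ^ 2) ≤
          C * (1 + tailMoment O w z y) / 256 ^ J := by
  obtain ⟨C, hC, h⟩ := exists_amplitudeEstimation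
  refine ⟨4 * C, by positivity, fun d y J => ?_⟩
  have hM : ∀ j : Fin J, (1 : ℝ) ≤ 16 ^ J / 2 ^ (j : ℕ) := by
    intro j
    rw [one_le_div (by positivity)]
    calc (2 : ℝ) ^ (j : ℕ) ≤ 16 ^ (j : ℕ) := by gcongr; norm_num
      _ ≤ 16 ^ J := pow_le_pow_right₀ (by norm_num) j.2.le
  choose x hq he using fun j : Fin J => h d (levelPayload y j) _ (hM j)
  refine ⟨(Proc.pi x).map fun v => ∑ j : Fin J, (2 : ℝ) ^ (j : ℕ) * v j, ?_, ?_⟩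
  · rw [Proc.queries_map]
    calc ((Proc.pi x).queries : ℝ) ≤ ((∑ j, (x j).queries : ℕ) : ℝ) := by
          exact_mod_cast Proc.queries_pi_le x
      _ ≤ ∑ j : Fin J, C * 16 ^ J * (1 / 2) ^ (j : ℕ) := by
          rw [Nat.cast_sum]
          refine Finset.sum_le_sum fun j _ => (hq j).trans (le_of_eq ?_)
          rw [one_div_pow]; ring
      _ ≤ C * 16 ^ J * 2 := by
          rw [← Finset.mul_sum]
          gcongr
          exact sum_half_pow_le J
      _ ≤ _ := by nlinarith [mul_pos hC (show (0 : ℝ) < 16 ^ J by positivity)]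
  · intro n O w z
    set a := markedWeight O w z with ha
    set S := tailMoment O w z y with hS
    have hS0 : 0 ≤ S := tailMoment_nonneg O w z y
    have hmean : ∑ i, tailWeight O w z i * truncate J (y (O.ret i)) =
        ∑ j : Fin J, (2 : ℝ) ^ (j : ℕ) * a (levelPayload y j) := by
      simp only [← sum_levelPayload, ha, markedWeight, Finset.mul_sum]
      rw [Finset.sum_comm]
      exact Finset.sum_congr rfl fun j _ => Finset.sum_congr rfl fun i _ => by ring
    have hlevel : ∀ j : Fin J, a (levelPayload y j) ≤ S / 1024 ^ (j : ℕ) := by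
      intro j
      rw [hS, tailMoment, Finset.sum_div]
      refine Finset.sum_le_sum fun i _ => ?_
      rw [mul_div_assoc]
      exact mul_le_mul_of_nonneg_left (levelPayload_le y j _) (tailWeight_nonneg O w z i)
    rw [Proc.expect_map, hmean]
    calc _ ≤ (Proc.pi x).expect a fun v =>
          ∑ j : Fin J, 2 * (8 : ℝ) ^ (j : ℕ) * (v j - a (levelPayload y j)) ^ 2 := by
          apply Proc.expect_mono
          intro v
          rw [← Finset.sum_sub_distrib]
          simp only [← mul_sub, mul_assoc]
          rw [← Finset.mul_sum]
          -- Cauchy-Schwarz with the weights `2 ^ (-j)`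
          have cs := Finset.sum_sq_le_sum_mul_sum_of_sq_le_mul Finset.univ
            (r := fun j : Fin J => (2 : ℝ) ^ (j : ℕ) * (v j - a (levelPayload y j)))
            (f := fun j : Fin J => (1 / 2 : ℝ) ^ (j : ℕ))
            (g := fun j : Fin J => (8 : ℝ) ^ (j : ℕ) * (v j - a (levelPayload y j)) ^ 2)
            (fun j _ => by positivity) (fun j _ => by positivity) (fun j _ => by
              have : ((2 : ℝ) ^ (j : ℕ)) ^ 2 = (1 / 2) ^ (j : ℕ) * 8 ^ (j : ℕ) := by
                rw [← mul_pow, ← pow_mul, mul_comm, pow_mul]; norm_num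
              exact le_of_eq (by rw [mul_pow, this]; ring))
          refine cs.trans ?_
          gcongr
          exact sum_half_pow_le J
      _ = ∑ j : Fin J, 2 * (8 : ℝ) ^ (j : ℕ) *
            (x j).expect a fun b => (b - a (levelPayload y j)) ^ 2 := by
          rw [Proc.expect_sum]
          refine Finset.sum_congr rfl fun j _ => ?_
          rw [Proc.expect_const_mul, Proc.expect_pi_apply a x j
            (fun b => (b - a (levelPayload y j)) ^ 2)]
      _ ≤ ∑ j : Fin J, (2 * C * (S + 1) / 256 ^ J) * (1 / 2) ^ (j : ℕ) := by
          refine Finset.sum_le_sum fun j _ => ?_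
          calc _ ≤ 2 * (8 : ℝ) ^ (j : ℕ) * (C * ((S / 1024 ^ (j : ℕ)) / (16 ^ J / 2 ^ (j : ℕ)) ^ 2 +
                1 / (16 ^ J / 2 ^ (j : ℕ)) ^ 4)) := by
                have := hlevel j
                have e := he j n O w z
                refine mul_le_mul_of_nonneg_left (e.trans ?_) (by positivity)
                gcongr
            _ = 2 * C * (S * (1 / 32) ^ (j : ℕ) / 256 ^ J +
                  (1 / 2) ^ (j : ℕ) * 256 ^ (j : ℕ) / 65536 ^ J) := by
                have e1 : (1024 : ℝ) ^ (j : ℕ) = 2 ^ (j : ℕ) * 2 ^ (j : ℕ) * 8 ^ (j : ℕ) *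
                    32 ^ (j : ℕ) := by
                  rw [← mul_pow, ← mul_pow, ← mul_pow]; norm_num
                have e2 : (256 : ℝ) ^ J = (16 ^ J) ^ 2 := by
                  rw [← pow_mul, mul_comm, pow_mul]; norm_num
                have e3 : (65536 : ℝ) ^ J = (16 ^ J) ^ 4 := by
                  rw [← pow_mul, mul_comm, pow_mul]; norm_num
                have e4 : (256 : ℝ) ^ (j : ℕ) = 2 ^ (j : ℕ) * 2 ^ (j : ℕ) * 2 ^ (j : ℕ) *
                    2 ^ (j : ℕ) * 2 ^ (j : ℕ) * 8 ^ (j : ℕ) := by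
                  simp only [← mul_pow]; norm_num
                rw [e1, e2, e3, e4, one_div_pow, one_div_pow]
                field_simp
            _ ≤ 2 * C * (S * (1 / 2) ^ (j : ℕ) / 256 ^ J +
                  (1 / 2) ^ (j : ℕ) * 256 ^ J / 65536 ^ J) := by
                have : (256 : ℝ) ^ (j : ℕ) ≤ 256 ^ J := pow_le_pow_right₀ (by norm_num) j.2.le
                gcongr
                norm_num
            _ = _ := by
                have e3 : (65536 : ℝ) ^ J = 256 ^ J * 256 ^ J := by
                  rw [← mul_pow]; norm_num
                rw [e3]
                field_simp
      _ ≤ (2 * C * (S + 1) / 256 ^ J) * 2 := by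
          rw [← Finset.mul_sum]
          gcongr
          exact sum_half_pow_le J
      _ = _ := by ring

/-- Estimation of the tail mean of a real function, from the truncated means of its positive and
negative parts and a bound for the bias. -/
lemma exists_realMean : ∃ C : ℝ, 0 < C ∧ ∀ (d : ℕ) (y : EuclideanSpace ℝ (Fin d) → ℝ) (J : ℕ),
    ∃ x : Proc d ℝ, (x.queries : ℝ) ≤ C * 16 ^ J ∧
      ∀ (n : ℕ) (O : ScenarioOracle n d) (w : EuclideanSpace ℝ (Fin d)) (z : ℝ),
        (x.expect (markedWeight O w z) fun v =>
          (v - ∑ i, tailWeight O w z i * y (O.ret i)) ^ 2) ≤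
          C * (1 + tailMoment O w z y) / 256 ^ J := by
  obtain ⟨C, hC, h⟩ := exists_truncatedMean
  refine ⟨6 * C + 3, by positivity, fun d y J => ?_⟩
  obtain ⟨x, hqx, hx⟩ := h d y J
  obtain ⟨x', hqx', hx'⟩ := h d (fun r => -y r) J
  refine ⟨x.bind fun v => x'.map fun v' => v - v', ?_, ?_⟩
  · have h1 := Proc.queries_bind_le x (fun v => x'.map fun v' => v - v') x'.queries
      (fun v => (Proc.queries_map _ _).le)
    calc _ ≤ ((x.queries + x'.queries : ℕ) : ℝ) := by exact_mod_cast h1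
      _ ≤ C * 16 ^ J + C * 16 ^ J := by push_cast; exact add_le_add hqx hqx'
      _ ≤ _ := by nlinarith [show (0 : ℝ) < 16 ^ J by positivity]
  · intro n O w z
    have e1 := hx n O w z
    have e2 := hx' n O w z
    have e3 : tailMoment O w z (fun r => -y r) = tailMoment O w z y := by
      simp only [tailMoment, abs_neg]
    rw [e3] at e2
    set a := markedWeight O w z with ha
    set S := tailMoment O w z y with hS
    have hS0 : 0 ≤ S := tailMoment_nonneg O w z y
    set m₁ := ∑ i, tailWeight O w z i * truncate J (y (O.ret i)) with hm₁
    set m₂ := ∑ i, tailWeight O w z i * truncate J (-y (O.ret i)) with hm₂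
    set m := ∑ i, tailWeight O w z i * y (O.ret i) with hm
    have hbias : (m - (m₁ - m₂)) ^ 2 ≤ S / 256 ^ J := by
      have : m - (m₁ - m₂) = ∑ i, tailWeight O w z i *
          (y (O.ret i) - (truncate J (y (O.ret i)) - truncate J (-y (O.ret i)))) := by
        simp only [hm, hm₁, hm₂, mul_sub, Finset.sum_sub_distrib]
      rw [this]
      refine (sq_sum_tailWeight_le O w z _).trans ?_
      rw [hS, tailMoment, Finset.sum_div]
      refine Finset.sum_le_sum fun i _ => ?_
      rw [mul_div_assoc]
      exact mul_le_mul_of_nonneg_left (sq_sub_truncate_le J _) (tailWeight_nonneg O w z i)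
    have hsplit : ∀ v v', (v - v' - m) ^ 2 ≤
        3 * (v - m₁) ^ 2 + 3 * (v' - m₂) ^ 2 + 3 * (m - (m₁ - m₂)) ^ 2 := by
      intro v v'
      nlinarith [sq_nonneg ((v - m₁) + (v' - m₂)), sq_nonneg ((v - m₁) + (m - (m₁ - m₂))),
        sq_nonneg ((v' - m₂) - (m - (m₁ - m₂)))]
    simp only [Proc.expect_bind, Proc.expect_map]
    calc _ ≤ x.expect a fun v => x'.expect a fun v' =>
          3 * (v - m₁) ^ 2 + 3 * (v' - m₂) ^ 2 + 3 * (m - (m₁ - m₂)) ^ 2 :=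
          Proc.expect_mono _ _ fun v => Proc.expect_mono _ _ fun v' => hsplit v v'
      _ = 3 * (x.expect a fun v => (v - m₁) ^ 2) + 3 * (x'.expect a fun v' => (v' - m₂) ^ 2) +
          3 * (m - (m₁ - m₂)) ^ 2 := by
          simp only [Proc.expect_add, Proc.expect_const, Proc.expect_const_mul]
      _ ≤ 3 * (C * (1 + S) / 256 ^ J) + 3 * (C * (1 + S) / 256 ^ J) + 3 * (S / 256 ^ J) := by
          gcongr
      _ ≤ 3 * (C * (1 + S) / 256 ^ J) + 3 * (C * (1 + S) / 256 ^ J) + 3 * ((1 + S) / 256 ^ J) := by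
          gcongr
          linarith
      _ = _ := by ring

/-! ### The tail mean of a vector by random rotations -/

section Walsh

/-- The sign `(-1) ^ b`. -/
def boolSign (b : Bool) : ℝ := if b then -1 else 1

lemma boolSign_sq (b : Bool) : boolSign b ^ 2 = 1 := by cases b <;> simp [boolSign]

/-- The Walsh functions, `(-1) ^ (l · t)`: the entries of a Hadamard matrix of size `2 ^ m`. -/
def walsh {m : ℕ} (l t : Bits m) : ℝ := ∏ i, boolSign (l i && t i)

lemma walsh_comm {m : ℕ} (l t : Bits m) : walsh l t = walsh t l := by
  simp only [walsh, Bool.and_comm]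

lemma walsh_sq {m : ℕ} (l t : Bits m) : walsh l t ^ 2 = 1 := by
  simp [walsh, ← Finset.prod_pow, boolSign_sq]

lemma sum_walsh_mul_walsh {m : ℕ} (t t' : Bits m) :
    ∑ l : Bits m, walsh l t * walsh l t' = if t = t' then (2 : ℝ) ^ m else 0 := by
  have h : ∑ l : Bits m, walsh l t * walsh l t' =
      ∏ i, ∑ b : Bool, boolSign (b && t i) * boolSign (b && t' i) := by
    rw [Finset.prod_univ_sum, Fintype.piFinset_univ]
    simp only [walsh, Finset.prod_mul_distrib]
  have h2 : ∀ i, ∑ b : Bool, boolSign (b && t i) * boolSign (b && t' i) =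
      if t i = t' i then 2 else 0 := by
    intro i
    rw [Fintype.sum_bool]
    cases t i <;> cases t' i <;> norm_num [boolSign]
  rw [h, Finset.prod_congr rfl fun i _ => h2 i]
  split_ifs with htt
  · simp [htt]
  · obtain ⟨i, hi⟩ := Function.ne_iff.1 htt
    exact Finset.prod_eq_zero (Finset.mem_univ i) (by simp [hi])

/-- Parseval's identity for the Walsh functions. -/
lemma sum_sq_sum_walsh {m : ℕ} (f : Bits m → ℝ) :
    ∑ t : Bits m, (∑ l, walsh l t * f l) ^ 2 = 2 ^ m * ∑ l, f l ^ 2 := by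
  calc _ = ∑ t : Bits m, ∑ l, ∑ l', (walsh t l * walsh t l') * (f l * f l') := by
        refine Finset.sum_congr rfl fun t _ => ?_
        rw [sq, Finset.sum_mul_sum]
        refine Finset.sum_congr rfl fun l _ => Finset.sum_congr rfl fun l' _ => ?_
        rw [walsh_comm l t, walsh_comm l' t]; ring
    _ = ∑ l, ∑ l', (∑ t : Bits m, walsh t l * walsh t l') * (f l * f l') := by
        rw [Finset.sum_comm]
        refine Finset.sum_congr rfl fun l _ => ?_
        rw [Finset.sum_comm]
        simp only [Finset.sum_mul]
    _ = _ := by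
        simp only [sum_walsh_mul_walsh, ite_mul, zero_mul, Finset.sum_ite_eq, Finset.mem_univ,
          if_true, Finset.mul_sum, sq]

end Walsh

section RandomSigns

/-- `d` independent fair bits. -/
def Proc.bits (d : ℕ) : Proc d (Fin d → Bool) := Proc.pi fun _ : Fin d => .toss fun b => .ret b

lemma Proc.queries_bits (d : ℕ) : (Proc.bits d).queries = 0 :=
  Nat.eq_zero_of_le_zero ((Proc.queries_pi_le _).trans (by simp [Proc.queries]))

variable {d : ℕ} (a : Payload d → ℝ)

/-- A Rademacher sum is sub-Gaussian, by `cosh x ≤ exp (x² / 2)`. -/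
lemma expect_bits_exp_le (c : Fin d → ℝ) :
    ((Proc.bits d).expect a fun s => Real.exp (∑ j, boolSign (s j) * c j)) ≤
      Real.exp ((∑ j, c j ^ 2) / 2) := by
  simp only [Real.exp_sum]
  have h := Proc.expect_pi_prod a (fun _ : Fin d => Proc.toss fun b => Proc.ret b)
    (fun j b => Real.exp (boolSign b * c j))
  rw [Proc.bits, h, Finset.sum_div, Real.exp_sum]
  refine Finset.prod_le_prod (fun j _ => Proc.expect_nonneg _ _ fun b => (Real.exp_pos _).le)
    fun j _ => ?_
  have := Real.cosh_le_exp_half_sq (c j)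
  rw [Real.cosh_eq] at this
  simp only [Proc.expect, boolSign, if_true, Bool.false_eq_true, if_false, one_mul, neg_mul]
  linarith

lemma expect_bits_pow_ten_le (c : Fin d → ℝ) (hc : ∑ j, c j ^ 2 ≤ 1) :
    ((Proc.bits d).expect a fun s => (1 + |∑ j, boolSign (s j) * c j|) ^ 10) ≤
      Nat.factorial 10 * (2 * Real.exp 2) := by
  have hpt : ∀ t : ℝ, (1 + |t|) ^ 10 ≤ Nat.factorial 10 * Real.exp 1 *
      (Real.exp t + Real.exp (-t)) := by
    intro t
    have h1 := Real.pow_div_factorial_le_exp (1 + |t|) (by positivity) 10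
    rw [div_le_iff₀ (by positivity), Real.exp_add] at h1
    have h2 : Real.exp |t| ≤ Real.exp t + Real.exp (-t) := by
      rcases abs_cases t with ⟨h, _⟩ | ⟨h, _⟩ <;> rw [h] <;>
        linarith [Real.exp_pos t, Real.exp_pos (-t)]
    calc _ ≤ _ := h1
      _ = Nat.factorial 10 * Real.exp 1 * Real.exp |t| := by ring
      _ ≤ _ := by gcongr
  have h1 := expect_bits_exp_le a c
  have h2 := expect_bits_exp_le a fun j => -c j
  simp only [mul_neg, Finset.sum_neg_distrib, neg_sq] at h2
  have h3 : Real.exp ((∑ j, c j ^ 2) / 2) ≤ Real.exp 1 := Real.exp_le_exp.2 (by linarith)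
  calc _ ≤ (Proc.bits d).expect a fun s => Nat.factorial 10 * Real.exp 1 *
        (Real.exp (∑ j, boolSign (s j) * c j) + Real.exp (-∑ j, boolSign (s j) * c j)) :=
        Proc.expect_mono _ _ fun s => hpt _
    _ ≤ Nat.factorial 10 * Real.exp 1 * (Real.exp 1 + Real.exp 1) := by
        rw [Proc.expect_const_mul, Proc.expect_add]
        gcongr
        · exact h1.trans h3
        · exact h2.trans h3
    _ = _ := by
        rw [show (2 : ℝ) = 1 + 1 by norm_num, Real.exp_add]; ring

end RandomSigns

section VectorMean

variable {n d : ℕ} (O : ScenarioOracle n d) (w : EuclideanSpace ℝ (Fin d)) (z : ℝ)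

/-- The unnormalized tail mean `E[-r · 1{L(w) ≥ z}]`. -/
def tailMean : EuclideanSpace ℝ (Fin d) := ∑ i, tailWeight O w z i • (-(O.ret i))

/-- The tail probability `Pr[L(w) ≥ z]`. -/
def tailProb : ℝ := ∑ i, tailWeight O w z i

/-- The returns are bounded by `G` on the scenarios of positive probability. -/
def ScenarioOracle.BoundedBy (G : ℝ) : Prop := ∀ i, O.p i ≠ 0 → ‖O.ret i‖ ≤ G

variable {O}

lemma ScenarioOracle.BoundedBy.norm_ret_le {G : ℝ} (h : O.BoundedBy G) {i : Bits n}
    (hi : tailWeight O w z i ≠ 0) : ‖O.ret i‖ ≤ G := by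
  refine h i fun h0 => hi ?_
  unfold tailWeight
  split_ifs
  exacts [h0, rfl]

/-- The conditional tail mean has norm at most `G`. -/
lemma ScenarioOracle.BoundedBy.norm_tailMean_le {G : ℝ} (h : O.BoundedBy G) :
    ‖tailMean O w z‖ ≤ G * tailProb O w z := by
  rw [tailMean, tailProb, Finset.mul_sum]
  refine (norm_sum_le _ _).trans (Finset.sum_le_sum fun i _ => ?_)
  rw [norm_smul, norm_neg, Real.norm_of_nonneg (tailWeight_nonneg O w z i), mul_comm]
  by_cases hi : tailWeight O w z i = 0
  · simp [hi]
  · exact mul_le_mul_of_nonneg_right (h.norm_ret_le w z hi) (tailWeight_nonneg O w z i)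

end VectorMean

/-- Estimation of the tail mean with `O(d M)` queries up to a mean square error `O(G² / M²)`, for
`M = 16 ^ J`. The return vector is rotated by a Hadamard matrix with random column signs, which
makes every coordinate of `r` sub-Gaussian of size `‖r‖ / √d`, so that all the coordinates can be
estimated from the same number of queries. -/
lemma exists_tailMeanEstimation : ∃ C : ℝ, 0 < C ∧ ∀ (d : ℕ) (G : ℝ) (J : ℕ), 0 < d → 0 < G →
    ∃ x : Proc d (EuclideanSpace ℝ (Fin d)), (x.queries : ℝ) ≤ C * (d * 16 ^ J) ∧
      ∀ (n : ℕ) (O : ScenarioOracle n d) (w : EuclideanSpace ℝ (Fin d)) (z : ℝ), O.BoundedBy G →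
        (x.expect (markedWeight O w z) fun v => ‖v - tailMean O w z‖ ^ 2) ≤ C * G ^ 2 / 256 ^ J := by
  obtain ⟨C, hC, h⟩ := exists_realMean
  set K : ℝ := Nat.factorial 10 * (2 * Real.exp 2) with hK
  have hK0 : 0 < K := by positivity
  refine ⟨C * (2 + K), by positivity, fun d G J hd hG => ?_⟩
  obtain ⟨m, hm1, hm2⟩ : ∃ m : ℕ, d ≤ 2 ^ m ∧ 2 ^ m ≤ 2 * d := by
    refine ⟨Nat.clog 2 d, Nat.le_pow_clog (by norm_num) d, ?_⟩
    rcases Nat.lt_or_ge 1 d with h1 | h1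
    · have h2 := Nat.pow_pred_clog_lt_self (by norm_num : 1 < 2) h1
      have h3 : 0 < Nat.clog 2 d := Nat.clog_pos (by norm_num) h1
      obtain ⟨c, hc⟩ := Nat.exists_eq_succ_of_ne_zero h3.ne'
      rw [hc] at h2 ⊢
      rw [Nat.pow_succ]
      simp only [Nat.pred_succ] at h2
      omega
    · have : d = 1 := by omega
      subst this
      simp
  obtain ⟨e⟩ : Nonempty (Fin d ↪ Bits m) :=
    Function.Embedding.nonempty_of_card_le (by simpa using hm1)
  -- coordinate `l` of the rotated return vector, rescaled to size `1`
  set y : (Fin d → Bool) → Bits m → EuclideanSpace ℝ (Fin d) → ℝ := fun s l r =>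
    ∑ j, boolSign (s j) * (walsh l (e j) * r j / G) with hy
  choose x hq hx using fun s l => h d (y s l) J
  set D : ℝ := 2 ^ m with hD
  have hD0 : 0 < D := by positivity
  -- the inverse rotation, together with the sign of the loss gradient `-r`
  set back : (Fin d → Bool) → (Bits m → ℝ) → EuclideanSpace ℝ (Fin d) := fun s u =>
    WithLp.toLp 2 fun j => -(G / D * boolSign (s j) * ∑ l, walsh l (e j) * u l) with hback
  refine ⟨(Proc.bits d).bind fun s => (Proc.pi (x s)).map (back s), ?_, ?_⟩
  · obtain ⟨B, hB⟩ : ∃ B : ℕ, B = ⌊(2 : ℝ) ^ m * (C * 16 ^ J)⌋₊ := ⟨_, rfl⟩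
    have h1 := Proc.queries_bind_le (Proc.bits d) (fun s => (Proc.pi (x s)).map (back s)) B
      (fun s => by
        rw [Proc.queries_map, hB]
        apply Nat.le_floor
        calc _ ≤ ((∑ l, (x s l).queries : ℕ) : ℝ) := by exact_mod_cast Proc.queries_pi_le (x s)
          _ ≤ ∑ l : Bits m, C * 16 ^ J := by
            rw [Nat.cast_sum]
            exact Finset.sum_le_sum fun l _ => hq s l
          _ = _ := by simp)
    rw [Proc.queries_bits, zero_add] at h1
    have h2 : (2 : ℝ) ^ m ≤ 2 * d := by exact_mod_cast hm2
    calc _ ≤ (B : ℝ) := by exact_mod_cast h1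
      _ ≤ (2 : ℝ) ^ m * (C * 16 ^ J) := by rw [hB]; exact Nat.floor_le (by positivity)
      _ ≤ 2 * d * (C * 16 ^ J) := by gcongr
      _ = C * 2 * (d * 16 ^ J) := by ring
      _ ≤ _ := by gcongr; linarith
  · intro n O w z hO
    set a := markedWeight O w z with ha
    set μ : (Fin d → Bool) → Bits m → ℝ := fun s l =>
      ∑ i, tailWeight O w z i * y s l (O.ret i) with hμ
    have hinv : ∀ s, back s (μ s) = tailMean O w z := by
      intro s
      ext j
      have h1 : ∀ r : EuclideanSpace ℝ (Fin d), ∑ l, walsh l (e j) * y s l r =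
          D * (boolSign (s j) * (r j / G)) := by
        intro r
        calc _ = ∑ j', (∑ l, walsh l (e j) * walsh l (e j')) * (boolSign (s j') * (r j' / G)) := by
              simp only [hy, Finset.mul_sum, Finset.sum_mul]
              rw [Finset.sum_comm]
              refine Finset.sum_congr rfl fun j' _ => Finset.sum_congr rfl fun l _ => by ring
          _ = _ := by simp [sum_walsh_mul_walsh, hD]
      have h2 : ∑ l, walsh l (e j) * μ s l =
          ∑ i, tailWeight O w z i * (D * (boolSign (s j) * (O.ret i j / G))) := by
        simp only [← h1, hμ, Finset.mul_sum]
        rw [Finset.sum_comm]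
        refine Finset.sum_congr rfl fun j' _ => Finset.sum_congr rfl fun l _ => by ring
      have h3 : (tailMean O w z) j = ∑ i, tailWeight O w z i * (-(O.ret i j)) := by
        simp [tailMean]
      rw [h3]
      change -(G / D * boolSign (s j) * ∑ l, walsh l (e j) * μ s l) = _
      rw [h2, Finset.mul_sum, ← Finset.sum_neg_distrib]
      refine Finset.sum_congr rfl fun i _ => ?_
      have h4 := boolSign_sq (s j)
      field_simp
      linear_combination (-(tailWeight O w z i * O.ret i j)) * h4
    have herr : ∀ s u, ‖back s u - tailMean O w z‖ ^ 2 ≤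
        G ^ 2 / D * ∑ l, (u l - μ s l) ^ 2 := by
      intro s u
      rw [← hinv s, EuclideanSpace.norm_sq_eq]
      have h1 : ∀ j, ‖(back s u - back s (μ s)) j‖ ^ 2 =
          (G / D) ^ 2 * (∑ l, walsh l (e j) * (u l - μ s l)) ^ 2 := by
        intro j
        have : (back s u - back s (μ s)) j =
            -(G / D * boolSign (s j) * ∑ l, walsh l (e j) * (u l - μ s l)) := by
          simp only [hback, PiLp.sub_apply, mul_sub, Finset.sum_sub_distrib]
          ring
        rw [this, Real.norm_eq_abs, sq_abs, neg_sq, mul_pow, mul_pow, boolSign_sq, mul_one]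
      simp only [h1]
      rw [← Finset.mul_sum]
      have h2 : ∑ j, (∑ l, walsh l (e j) * (u l - μ s l)) ^ 2 ≤
          ∑ t : Bits m, (∑ l, walsh l t * (u l - μ s l)) ^ 2 := by
        rw [← Finset.sum_map Finset.univ e fun t => (∑ l, walsh l t * (u l - μ s l)) ^ 2]
        exact Finset.sum_le_sum_of_subset_of_nonneg (Finset.subset_univ _)
          fun _ _ _ => sq_nonneg _
      rw [sum_sq_sum_walsh] at h2
      calc _ ≤ (G / D) ^ 2 * (2 ^ m * ∑ l, (u l - μ s l) ^ 2) := by gcongr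
        _ = _ := by rw [← hD]; field_simp
    have hmom : ∀ l, ((Proc.bits d).expect a fun s => tailMoment O w z (y s l)) ≤ K := by
      intro l
      simp only [tailMoment, Proc.expect_sum, Proc.expect_const_mul]
      calc _ ≤ ∑ i, tailWeight O w z i * K := by
            refine Finset.sum_le_sum fun i _ => ?_
            by_cases hi : tailWeight O w z i = 0
            · simp [hi]
            · refine mul_le_mul_of_nonneg_left (expect_bits_pow_ten_le a _ ?_)
                (tailWeight_nonneg O w z i)
              simp only [div_pow, mul_pow, walsh_sq, one_mul]
              rw [← Finset.sum_div, div_le_one (by positivity)]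
              have h1 := EuclideanSpace.norm_sq_eq (O.ret i)
              simp only [Real.norm_eq_abs, sq_abs] at h1
              rw [← h1]
              exact pow_le_pow_left₀ (norm_nonneg _) (hO.norm_ret_le w z hi) 2
        _ = (∑ i, tailWeight O w z i) * K := by rw [Finset.sum_mul]
        _ ≤ K := mul_le_of_le_one_left hK0.le (sum_tailWeight_le_one O w z)
    simp only [Proc.expect_bind, Proc.expect_map]
    calc _ ≤ (Proc.bits d).expect a fun s => (Proc.pi (x s)).expect a fun u =>
          G ^ 2 / D * ∑ l, (u l - μ s l) ^ 2 :=
          Proc.expect_mono _ _ fun s => Proc.expect_mono _ _ fun u => herr s u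
      _ = (Proc.bits d).expect a fun s => G ^ 2 / D * ∑ l,
          (x s l).expect a fun v => (v - μ s l) ^ 2 := by
          congr 1
          funext s
          rw [Proc.expect_const_mul, Proc.expect_sum]
          congr 1
          refine Finset.sum_congr rfl fun l _ => ?_
          exact Proc.expect_pi_apply a (x s) l fun v => (v - μ s l) ^ 2
      _ ≤ (Proc.bits d).expect a fun s => G ^ 2 / D * ∑ l : Bits m,
          (C / 256 ^ J + C / 256 ^ J * tailMoment O w z (y s l)) := by
          refine Proc.expect_mono _ _ fun s => ?_
          gcongr with l
          exact (hx s l n O w z).trans (le_of_eq (by ring))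
      _ = G ^ 2 / D * ∑ l : Bits m, (C / 256 ^ J + C / 256 ^ J *
          (Proc.bits d).expect a fun s => tailMoment O w z (y s l)) := by
          rw [Proc.expect_const_mul, Proc.expect_sum]
          simp only [Proc.expect_add, Proc.expect_const, Proc.expect_const_mul]
      _ ≤ G ^ 2 / D * ∑ l : Bits m, (C / 256 ^ J + C / 256 ^ J * K) := by
          gcongr with l
          exact hmom l
      _ = C * (1 + K) * G ^ 2 / 256 ^ J := by
          simp only [Finset.sum_const, Finset.card_univ, Fintype.card_fun, Fintype.card_bool,
            Fintype.card_fin, nsmul_eq_mul]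
          push_cast
          rw [← hD]
          field_simp
      _ ≤ _ := by gcongr; linarith

/-- Estimation of the conditional tail mean, if the tail probability is bounded below. The estimate of
the tail probability is raised to its lower bound `β`, which does not increase its error and keeps
the quotient stable. -/
lemma exists_conditionalMeanEstimation {β : ℝ} (hβ : 0 < β) : ∃ C : ℝ, 0 < C ∧
    ∀ (d : ℕ) (G : ℝ) (J : ℕ), 0 < d → 0 < G →
    ∃ x : Proc d (EuclideanSpace ℝ (Fin d)), (x.queries : ℝ) ≤ C * (d * 16 ^ J) ∧
      ∀ (n : ℕ) (O : ScenarioOracle n d) (w : EuclideanSpace ℝ (Fin d)) (z : ℝ), O.BoundedBy G →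
        β ≤ tailProb O w z →
        (x.expect (markedWeight O w z) fun v => ‖v - (tailProb O w z)⁻¹ • tailMean O w z‖ ^ 2) ≤
          C * G ^ 2 / 256 ^ J := by
  obtain ⟨C₁, hC₁, h₁⟩ := exists_amplitudeEstimation
  obtain ⟨C₂, hC₂, h₂⟩ := exists_tailMeanEstimation
  have hC0 : 0 ≤ 2 * (β⁻¹) ^ 2 * (C₂ + 2 * C₁) := by positivity
  refine ⟨C₁ + C₂ + 2 * (β⁻¹) ^ 2 * (C₂ + 2 * C₁), by positivity, fun d G J hd hG => ?_⟩
  have hM : (1 : ℝ) ≤ 16 ^ J := one_le_pow₀ (by norm_num)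
  obtain ⟨x₁, hq₁, hx₁⟩ := h₁ d (fun _ => 1) (16 ^ J) hM
  obtain ⟨x₂, hq₂, hx₂⟩ := h₂ d G J hd hG
  refine ⟨x₁.bind fun q => x₂.map fun v => (max q β)⁻¹ • v, ?_, ?_⟩
  · have h := Proc.queries_bind_le x₁ (fun q => x₂.map fun v => (max q β)⁻¹ • v) x₂.queries
      (fun q => (Proc.queries_map _ _).le)
    have hd1 : (1 : ℝ) ≤ d := by exact_mod_cast hd
    calc _ ≤ ((x₁.queries + x₂.queries : ℕ) : ℝ) := by exact_mod_cast h
      _ ≤ C₁ * (1 * 16 ^ J) + C₂ * (d * 16 ^ J) := by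
          push_cast; rw [one_mul]; exact add_le_add hq₁ hq₂
      _ ≤ C₁ * (d * 16 ^ J) + C₂ * (d * 16 ^ J) := by gcongr
      _ = (C₁ + C₂) * (d * 16 ^ J) := by ring
      _ ≤ _ := mul_le_mul_of_nonneg_right (by linarith) (by positivity)
  · intro n O w z hO hβq
    have e₁ := hx₁ n O w z
    have e₂ := hx₂ n O w z hO
    have hone : markedWeight O w z (fun _ => 1) = tailProb O w z := by
      simp [markedWeight, tailProb]
    have hnorm := hO.norm_tailMean_le w z
    rw [hone] at e₁
    set a := markedWeight O w z with ha
    set q := tailProb O w z with hq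
    set μ := tailMean O w z with hμ
    have hq0 : 0 < q := by linarith
    have hq1 : q ≤ 1 := sum_tailWeight_le_one O w z
    have hpt : ∀ (t : ℝ) (v : EuclideanSpace ℝ (Fin d)), ‖(max t β)⁻¹ • v - q⁻¹ • μ‖ ^ 2 ≤
        2 * (β⁻¹) ^ 2 * (‖v - μ‖ ^ 2 + G ^ 2 * (t - q) ^ 2) := by
      intro t v
      set Q := max t β with hQ
      have hQβ : β ≤ Q := le_max_right _ _
      have hQ0 : 0 < Q := by linarith
      have hQq : |Q - q| ≤ |t - q| := by
        rcases le_total t β with h | h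
        · rw [hQ, max_eq_right h, abs_of_nonpos (by linarith), abs_of_nonpos (by linarith)]
          linarith
        · rw [hQ, max_eq_left h]
      have h1 : Q⁻¹ • v - q⁻¹ • μ = Q⁻¹ • (v - μ) + (Q⁻¹ - q⁻¹) • μ := by
        rw [smul_sub, sub_smul]; abel
      have h2 : ‖(Q⁻¹ - q⁻¹) • μ‖ ≤ β⁻¹ * (G * |t - q|) := by
        rw [norm_smul, Real.norm_eq_abs]
        have : |Q⁻¹ - q⁻¹| = |Q - q| / (Q * q) := by
          rw [inv_sub_inv hQ0.ne' hq0.ne', abs_div, abs_sub_comm, abs_of_pos (mul_pos hQ0 hq0)]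
        rw [this]
        calc _ ≤ |t - q| / (Q * q) * (G * q) := by gcongr
          _ = Q⁻¹ * (G * |t - q|) := by field_simp
          _ ≤ _ := by gcongr
      have h3 : ‖Q⁻¹ • (v - μ)‖ ≤ β⁻¹ * ‖v - μ‖ := by
        rw [norm_smul, norm_inv, Real.norm_of_nonneg hQ0.le]
        gcongr
      have h4 : ‖Q⁻¹ • v - q⁻¹ • μ‖ ≤ β⁻¹ * (‖v - μ‖ + G * |t - q|) := by
        rw [h1, mul_add]
        exact (norm_add_le _ _).trans (add_le_add h3 h2)
      calc _ ≤ (β⁻¹ * (‖v - μ‖ + G * |t - q|)) ^ 2 := by gcongr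
        _ = (β⁻¹) ^ 2 * (‖v - μ‖ + G * |t - q|) ^ 2 := by ring
        _ ≤ (β⁻¹) ^ 2 * (2 * (‖v - μ‖ ^ 2 + G ^ 2 * (t - q) ^ 2)) := by
          gcongr
          rw [← sq_abs (t - q)]
          nlinarith [sq_nonneg (‖v - μ‖ - G * |t - q|)]
        _ = _ := by ring
    have e₁' : (x₁.expect a fun t => (t - q) ^ 2) ≤ 2 * C₁ / 256 ^ J := by
      refine e₁.trans ?_
      have h5 : ((16 : ℝ) ^ J) ^ 2 = 256 ^ J := by rw [← pow_mul, mul_comm, pow_mul]; norm_num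
      have h6 : ((16 : ℝ) ^ J) ^ 2 ≤ ((16 : ℝ) ^ J) ^ 4 := pow_le_pow_right₀ hM (by norm_num)
      rw [← h5]
      calc _ ≤ C₁ * (1 / ((16 : ℝ) ^ J) ^ 2 + 1 / ((16 : ℝ) ^ J) ^ 2) := by gcongr
        _ = _ := by ring
    simp only [Proc.expect_bind, Proc.expect_map]
    calc _ ≤ x₁.expect a fun t => x₂.expect a fun v =>
          2 * (β⁻¹) ^ 2 * (‖v - μ‖ ^ 2 + G ^ 2 * (t - q) ^ 2) :=
          Proc.expect_mono _ _ fun t => Proc.expect_mono _ _ fun v => hpt t v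
      _ = 2 * (β⁻¹) ^ 2 * ((x₂.expect a fun v => ‖v - μ‖ ^ 2) +
          G ^ 2 * x₁.expect a fun t => (t - q) ^ 2) := by
          simp only [Proc.expect_add, Proc.expect_const, Proc.expect_const_mul]
      _ ≤ 2 * (β⁻¹) ^ 2 * (C₂ * G ^ 2 / 256 ^ J + G ^ 2 * (2 * C₁ / 256 ^ J)) := by gcongr
      _ = 2 * (β⁻¹) ^ 2 * (C₂ + 2 * C₁) * G ^ 2 / 256 ^ J := by ring
      _ ≤ _ := by gcongr; linarith

/-! ### Value-at-Risk, scenario laws and boosting -/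

section ValueAtRisk

variable {d : ℕ}

lemma continuous_portfolioLoss (w : EuclideanSpace ℝ (Fin d)) : Continuous (portfolioLoss w) := by
  unfold portfolioLoss
  fun_prop

lemma measurableSet_tailEvent (w : EuclideanSpace ℝ (Fin d)) (z : ℝ) :
    MeasurableSet (tailEvent w z) :=
  measurableSet_le measurable_const (continuous_portfolioLoss w).measurable

/-- The tail beyond the Value-at-Risk has probability at least `1 - α`, since the losses below it
have probability at most `α`. -/
lemma one_sub_le_tail_valueAtRisk {α G : ℝ} (hα0 : 0 < α)
    (D : Measure (EuclideanSpace ℝ (Fin d))) [IsProbabilityMeasure D]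
    (w : EuclideanSpace ℝ (Fin d)) (hD : ∀ᵐ r ∂D, ‖r‖ ≤ G) :
    1 - α ≤ D.real (tailEvent w (valueAtRisk α D w)) := by
  set S := {z : ℝ | α ≤ D.real {r | portfolioLoss w r ≤ z}} with hS
  set v := valueAtRisk α D w with hv
  -- without a lower bound for `S`, the infimum would be a junk value
  have hbdd : BddBelow S := by
    refine ⟨-(‖w‖ * G), fun z hz => ?_⟩
    by_contra hlt
    push Not at hlt
    have h0 : D {r | portfolioLoss w r ≤ z} = 0 := by
      rw [← compl_mem_ae_iff]
      filter_upwards [hD] with r hr hle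
      have h1 := real_inner_le_norm w r
      have h2 : ‖w‖ * ‖r‖ ≤ ‖w‖ * G := by gcongr
      have h3 : -(inner ℝ w r) ≤ z := hle
      linarith
    have : α ≤ D.real {r | portfolioLoss w r ≤ z} := hz
    rw [measureReal_def, h0, ENNReal.toReal_zero] at this
    linarith
  have hlt : ∀ k : ℕ, D {r | portfolioLoss w r ≤ v - 1 / (k + 1)} ≤ ENNReal.ofReal α := by
    intro k
    have hk : v - 1 / (k + 1 : ℝ) ∉ S := by
      apply notMem_of_lt_csInf _ hbdd
      have : (0 : ℝ) < 1 / (k + 1) := by positivity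
      change v - 1 / (k + 1 : ℝ) < v
      linarith
    have h2 : D.real {r | portfolioLoss w r ≤ v - 1 / (k + 1)} < α := not_le.1 hk
    rw [← ENNReal.ofReal_toReal (measure_ne_top D {r | portfolioLoss w r ≤ v - 1 / (k + 1)})]
    exact ENNReal.ofReal_le_ofReal h2.le
  have hunion : {r | portfolioLoss w r < v} = ⋃ k : ℕ, {r | portfolioLoss w r ≤ v - 1 / (k + 1)} := by
    ext r
    simp only [Set.mem_ofPred_eq, Set.mem_iUnion]
    constructor
    · intro h
      obtain ⟨k, hk⟩ := exists_nat_one_div_lt (sub_pos.2 h)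
      exact ⟨k, by linarith⟩
    · rintro ⟨k, hk⟩
      have : (0 : ℝ) < 1 / (k + 1) := by positivity
      linarith
  have hmono : Monotone fun k : ℕ => {r | portfolioLoss w r ≤ v - 1 / (k + 1)} := by
    intro k l hkl r hr
    have h1 : (1 : ℝ) / (l + 1) ≤ 1 / (k + 1) := by gcongr
    simp only [Set.mem_ofPred_eq] at hr ⊢
    linarith
  have hle : D {r | portfolioLoss w r < v} ≤ ENNReal.ofReal α := by
    rw [hunion]
    exact le_of_tendsto' (tendsto_measure_iUnion_atTop hmono) hlt
  have hcompl : (tailEvent w v)ᶜ = {r | portfolioLoss w r < v} := by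
    ext r; simp [tailEvent]
  have h3 : D.real (tailEvent w v)ᶜ ≤ α := by
    rw [hcompl]
    exact ENNReal.toReal_le_of_le_ofReal hα0.le hle
  rw [probReal_compl_eq_one_sub (measurableSet_tailEvent w v)] at h3
  linarith

lemma cvarSubgradient_eq (α : ℝ) (D : Measure (EuclideanSpace ℝ (Fin d)))
    (w : EuclideanSpace ℝ (Fin d)) :
    cvarSubgradient α D w = (D.real (tailEvent w (valueAtRisk α D w)))⁻¹ •
      ∫ r in tailEvent w (valueAtRisk α D w), -r ∂D := by
  rw [cvarSubgradient, ProbabilityTheory.cond, integral_smul_measure, ENNReal.toReal_inv]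
  rfl

lemma norm_cvarSubgradient_le {α G : ℝ} (hG : 0 ≤ G) (D : Measure (EuclideanSpace ℝ (Fin d)))
    [IsProbabilityMeasure D] (w : EuclideanSpace ℝ (Fin d)) (hD : ∀ᵐ r ∂D, ‖r‖ ≤ G) :
    ‖cvarSubgradient α D w‖ ≤ G := by
  rw [cvarSubgradient_eq]
  set T := tailEvent w (valueAtRisk α D w) with hT
  have h1 : ‖∫ r in T, -r ∂D‖ ≤ G * D.real T := by
    apply norm_setIntegral_le_of_norm_le_const_ae (measure_lt_top D T)
    filter_upwards [ae_restrict_of_ae hD] with r hr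
    rwa [norm_neg]
  rw [norm_smul, norm_inv, Real.norm_of_nonneg measureReal_nonneg]
  calc _ ≤ (D.real T)⁻¹ * (G * D.real T) := by gcongr
    _ = G * ((D.real T)⁻¹ * D.real T) := by ring
    _ ≤ G * 1 := by gcongr; exact inv_mul_le_one
    _ = G := mul_one G

end ValueAtRisk

section Law

variable {n d : ℕ} (O : ScenarioOracle n d)

instance : IsProbabilityMeasure O.law := by
  constructor
  simp only [ScenarioOracle.law, Measure.finsetSum_apply, Measure.smul_apply, measure_univ,
    smul_eq_mul, mul_one]
  rw [← ENNReal.ofReal_sum_of_nonneg fun i _ => O.p_nonneg i, O.p_sum, ENNReal.ofReal_one]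

lemma ScenarioOracle.boundedBy_of_ae {G : ℝ} (h : ∀ᵐ r ∂O.law, ‖r‖ ≤ G) : O.BoundedBy G := by
  intro i hi
  rw [ScenarioOracle.law, ae_finsetSum_measure_iff] at h
  have h1 := h i (Finset.mem_univ i)
  have hpos : ENNReal.ofReal (O.p i) ≠ 0 :=
    (ENNReal.ofReal_pos.2 (lt_of_le_of_ne (O.p_nonneg i) (Ne.symm hi))).ne'
  rw [Measure.ae_ennreal_smul_measure_iff hpos, ae_dirac_eq] at h1
  exact h1

lemma setIntegral_law (w : EuclideanSpace ℝ (Fin d)) (z : ℝ)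
    {F : Type*} [NormedAddCommGroup F] [NormedSpace ℝ F] [CompleteSpace F]
    (f : EuclideanSpace ℝ (Fin d) → F) :
    ∫ r in tailEvent w z, f r ∂O.law = ∑ i, tailWeight O w z i • f (O.ret i) := by
  classical
  rw [← integral_indicator (measurableSet_tailEvent w z), ScenarioOracle.law,
    integral_finsetSum_measure]
  · refine Finset.sum_congr rfl fun i _ => ?_
    rw [integral_smul_measure, integral_dirac, ENNReal.toReal_ofReal (O.p_nonneg i), tailWeight,
      Set.indicator_apply]
    split_ifs <;> simp
  · intro i _
    exact (integrable_dirac (by simp)).smul_measure ENNReal.ofReal_ne_top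

lemma tailProb_eq (w : EuclideanSpace ℝ (Fin d)) (z : ℝ) :
    tailProb O w z = O.law.real (tailEvent w z) := by
  have h := setIntegral_law O w z (fun _ => (1 : ℝ))
  simpa [tailProb] using h.symm

lemma cvarSubgradient_law (α : ℝ) (w : EuclideanSpace ℝ (Fin d)) :
    cvarSubgradient α O.law w = (tailProb O w (valueAtRisk α O.law w))⁻¹ •
      tailMean O w (valueAtRisk α O.law w) := by
  rw [cvarSubgradient_eq, tailProb_eq, setIntegral_law, tailMean]

end Law

section Boosting

open Classical in
/-- A vector of the list `v` that lies within `2δ` of more than half of the list, if there is one, and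
`0` otherwise. -/
def clusterPoint {E : Type} [NormedAddCommGroup E] {R : ℕ} (δ : ℝ) (v : Fin R → E) : E :=
  if h : ∃ i, R < 2 * (Finset.univ.filter fun j => ‖v i - v j‖ ≤ 2 * δ).card
  then v h.choose else 0

open Classical in
/-- If more than half of the list lies within `δ` of `g`, the chosen vector is within `3δ` of `g`. -/
lemma norm_clusterPoint_sub_le {E : Type} [NormedAddCommGroup E] {R : ℕ} {δ : ℝ} {v : Fin R → E}
    {g : E} (h : R < 2 * (Finset.univ.filter fun j => ‖v j - g‖ ≤ δ).card) :
    ‖clusterPoint δ v - g‖ ≤ 3 * δ := by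
  set A := Finset.univ.filter fun j => ‖v j - g‖ ≤ δ with hA
  have hA0 : 0 < A.card := by omega
  obtain ⟨i, hi⟩ := Finset.card_pos.1 hA0
  have hex : ∃ i, R < 2 * (Finset.univ.filter fun j => ‖v i - v j‖ ≤ 2 * δ).card := by
    refine ⟨i, h.trans_le (Nat.mul_le_mul_left 2 (Finset.card_le_card fun j hj => ?_))⟩
    simp only [hA, Finset.mem_filter, Finset.mem_univ, true_and] at hi hj ⊢
    calc ‖v i - v j‖ = ‖(v i - g) - (v j - g)‖ := by congr 1; abel
      _ ≤ ‖v i - g‖ + ‖v j - g‖ := norm_sub_le _ _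
      _ ≤ 2 * δ := by linarith
  rw [clusterPoint, dif_pos hex]
  have hspec := hex.choose_spec
  set k := hex.choose with hk
  set B := Finset.univ.filter fun j => ‖v k - v j‖ ≤ 2 * δ with hB
  -- two majorities intersect
  have hAB : (A ∩ B).Nonempty := by
    rw [← Finset.card_pos]
    have h1 := Finset.card_union_add_card_inter A B
    have h2 : (A ∪ B).card ≤ R := by simpa using Finset.card_le_univ (A ∪ B)
    omega
  obtain ⟨j, hj⟩ := hAB
  simp only [hA, hB, Finset.mem_inter, Finset.mem_filter, Finset.mem_univ, true_and] at hj
  calc ‖v k - g‖ = ‖(v k - v j) + (v j - g)‖ := by congr 1; abel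
    _ ≤ ‖v k - v j‖ + ‖v j - g‖ := norm_add_le _ _
    _ ≤ 3 * δ := by linarith [hj.1, hj.2]

variable {d : ℕ}

open Classical in
/-- If every run fails with probability at most `1 / 16`, half of `R` independent runs fail with
probability at most `2 ^ (-R)`: this is Markov's inequality for `16 ^ k / 4 ^ R`, with `k` the number
of failures. -/
lemma expect_clusterPoint_le (a : Payload d → ℝ) (x : Proc d (EuclideanSpace ℝ (Fin d))) (R : ℕ)
    {δ : ℝ} {g : EuclideanSpace ℝ (Fin d)}
    (h : (x.expect a fun v => if ‖v - g‖ ≤ δ then (0 : ℝ) else 1) ≤ 1 / 16) :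
    ((Proc.pi fun _ : Fin R => x).expect a fun v =>
      if ‖clusterPoint δ v - g‖ ≤ 3 * δ then (0 : ℝ) else 1) ≤ (1 / 2) ^ R := by
  have hprod := Proc.expect_pi_prod a (fun _ : Fin R => x)
    (fun _ v => (1 / 4 : ℝ) + 15 / 4 * (if ‖v - g‖ ≤ δ then (0 : ℝ) else 1))
  calc _ ≤ (Proc.pi fun _ : Fin R => x).expect a fun v =>
        ∏ i, ((1 / 4 : ℝ) + 15 / 4 * (if ‖v i - g‖ ≤ δ then (0 : ℝ) else 1)) := by
        apply Proc.expect_mono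
        intro v
        have hfac : ∀ i, (1 / 4 : ℝ) + 15 / 4 * (if ‖v i - g‖ ≤ δ then (0 : ℝ) else 1) =
            if ‖v i - g‖ ≤ δ then 1 / 4 else 4 := by
          intro i; split_ifs <;> norm_num
        simp only [hfac]
        rw [Finset.prod_ite, Finset.prod_const, Finset.prod_const]
        split_ifs with hc
        · positivity
        · have hno := mt (norm_clusterPoint_sub_le (δ := δ) (v := v) (g := g)) hc
          have hcard := Finset.card_filter_add_card_filter_not (s := Finset.univ)
            (fun i => ‖v i - g‖ ≤ δ)
          rw [Finset.card_univ, Fintype.card_fin] at hcard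
          set A := (Finset.univ.filter fun i => ‖v i - g‖ ≤ δ).card
          set B := (Finset.univ.filter fun i => ¬ ‖v i - g‖ ≤ δ).card
          have hAB : A ≤ B := by omega
          rw [one_div, inv_pow, inv_mul_eq_div, one_le_div (by positivity)]
          exact pow_le_pow_right₀ (by norm_num) hAB
    _ = (1 / 4 + 15 / 4 * x.expect a fun v => if ‖v - g‖ ≤ δ then (0 : ℝ) else 1) ^ R := by
        rw [hprod, Finset.prod_const, Finset.card_univ, Fintype.card_fin, Proc.expect_add,
          Proc.expect_const, Proc.expect_const_mul]
    _ ≤ _ := by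
        have h0 : 0 ≤ x.expect a fun v => if ‖v - g‖ ≤ δ then (0 : ℝ) else 1 :=
          Proc.expect_nonneg _ _ fun v => by split_ifs <;> norm_num
        exact pow_le_pow_left₀ (by linarith) (by linarith) R

end Boosting

/-- The quantum estimator of the CVaR subgradient. -/
lemma exists_cvarEstimator {α G : ℝ} (hα0 : 0 < α) (hα1 : α < 1) (hG : 0 < G) :
    ∃ C : ℝ, 0 < C ∧ ∀ (d : ℕ) (ε η : ℝ), 0 < ε → 0 < η → η ≤ 1 / 2 →
      ∃ E : QAEstimator d,
        (E.queries : ℝ) ≤ C * ((d : ℝ) / ε * Real.log (1 / η)) ∧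
        ∀ (n : ℕ) (O : ScenarioOracle n d) (w : EuclideanSpace ℝ (Fin d)),
          (∀ᵐ r ∂O.law, ‖r‖ ≤ G) →
          1 - η ≤ E.prob O w (valueAtRisk α O.law w)
            {v | ‖v - cvarSubgradient α O.law w‖ ≤ ε} := by
  classical
  obtain ⟨C, hC, h⟩ := exists_conditionalMeanEstimation (sub_pos.2 hα1)
  have hlog2 : 0 < Real.log 2 := Real.log_pos (by norm_num)
  -- with `M ≥ L G / ε`, the probability of an error above `ε / 3` is at most `9 C / L² ≤ 1 / 16`
  set L := 12 * Real.sqrt C + 1 with hL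
  have hL1 : 1 ≤ L := by have := Real.sqrt_nonneg C; linarith
  refine ⟨C * (16 * L * G) * (2 / Real.log 2), by positivity, fun d ε η hε hη hη2 => ?_⟩
  have hlogη : Real.log 2 ≤ Real.log (1 / η) := by
    apply Real.log_le_log (by norm_num)
    rw [le_div_iff₀ hη]; linarith
  by_cases htriv : d = 0 ∨ G ≤ ε
  · -- the zero vector is accurate enough
    refine ⟨.output 0, ?_, ?_⟩
    · simp only [QAEstimator.queries, Nat.cast_zero]
      have : 0 ≤ (d : ℝ) / ε * Real.log (1 / η) := mul_nonneg (by positivity) (by linarith)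
      positivity
    · intro n O w hO
      have hle : ‖(0 : EuclideanSpace ℝ (Fin d)) - cvarSubgradient α O.law w‖ ≤ ε := by
        rcases htriv with hd | hGε
        · subst hd
          rw [Subsingleton.elim (0 - cvarSubgradient α O.law w) 0, norm_zero]
          exact hε.le
        · rw [zero_sub, norm_neg]
          exact (norm_cvarSubgradient_le hG.le O.law w hO).trans hGε
      simp only [QAEstimator.prob, Set.mem_ofPred_eq, hle, if_true]
      linarith
  · push Not at htriv
    obtain ⟨hd, hεG⟩ := htriv
    have hd0 : 0 < d := Nat.pos_of_ne_zero hd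
    -- `M = 16 ^ J` is of the order of `G / ε`, and `2 ^ R` of the order of `1 / η`
    obtain ⟨J', hJ1, hJ2⟩ := exists_nat_pow_near (x := L * G / ε) (y := 16)
      (by rw [one_le_div hε]; nlinarith) (by norm_num)
    set J := J' + 1 with hJ
    have hJle : (16 : ℝ) ^ J ≤ 16 * L * G / ε := by
      rw [hJ, pow_succ]
      calc _ ≤ L * G / ε * 16 := by gcongr
        _ = _ := by ring
    obtain ⟨x, hq, hx⟩ := h d G J hd0 hG
    set R := ⌈Real.log (1 / η) / Real.log 2⌉₊ with hR
    have hR1 : (R : ℝ) ≤ 2 / Real.log 2 * Real.log (1 / η) := by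
      have h1 := (Nat.ceil_lt_add_one
        (a := Real.log (1 / η) / Real.log 2) (div_nonneg (by linarith) hlog2.le)).le
      have h2 : 1 ≤ Real.log (1 / η) / Real.log 2 := by rwa [one_le_div hlog2]
      calc (R : ℝ) ≤ _ := h1
        _ ≤ Real.log (1 / η) / Real.log 2 + Real.log (1 / η) / Real.log 2 := by linarith
        _ = _ := by ring
    have hR2 : (1 / 2 : ℝ) ^ R ≤ η := by
      have h1 := Nat.le_ceil (Real.log (1 / η) / Real.log 2)
      rw [div_le_iff₀ hlog2, ← hR, ← Real.log_pow] at h1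
      have h2 := (Real.log_le_log_iff (by positivity) (by positivity)).1 h1
      rw [one_div_pow]
      exact (one_div_le hη (by positivity)).1 h2
    refine ⟨((Proc.pi fun _ : Fin R => x).map (clusterPoint (ε / 3))).toEstimator, ?_, ?_⟩
    · rw [Proc.queries_toEstimator, Proc.queries_map]
      have h1 := Proc.queries_pi_le fun _ : Fin R => x
      rw [Finset.sum_const, Finset.card_univ, Fintype.card_fin, smul_eq_mul] at h1
      calc _ ≤ ((R * x.queries : ℕ) : ℝ) := by exact_mod_cast h1
        _ ≤ (2 / Real.log 2 * Real.log (1 / η)) * (C * (d * (16 * L * G / ε))) := by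
            push_cast
            have : 0 ≤ Real.log (1 / η) := by linarith
            refine mul_le_mul hR1 (hq.trans (by gcongr)) (by positivity) (by positivity)
        _ = _ := by ring
    · intro n O w hO
      rw [Proc.prob_toEstimator, Proc.expect_map]
      set z := valueAtRisk α O.law w with hz
      set a := markedWeight O w z with ha
      set g := cvarSubgradient α O.law w with hg
      have htail : 1 - α ≤ tailProb O w z := by
        rw [tailProb_eq]
        exact one_sub_le_tail_valueAtRisk hα0 O.law w hO
      have hE := hx n O w z (O.boundedBy_of_ae hO) htail
      rw [← cvarSubgradient_law, ← hg] at hE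
      have hbad : (x.expect a fun v => if ‖v - g‖ ≤ ε / 3 then (0 : ℝ) else 1) ≤ 1 / 16 := by
        calc _ ≤ x.expect a fun v => 9 / ε ^ 2 * ‖v - g‖ ^ 2 := by
              apply Proc.expect_mono
              intro v
              split_ifs with hv
              · positivity
              · push Not at hv
                have : (ε / 3) ^ 2 ≤ ‖v - g‖ ^ 2 := by gcongr
                calc (1 : ℝ) = 9 / ε ^ 2 * (ε / 3) ^ 2 := by field_simp; norm_num
                  _ ≤ _ := by gcongr
          _ ≤ 9 / ε ^ 2 * (C * G ^ 2 / 256 ^ J) := by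
              rw [Proc.expect_const_mul]
              gcongr
          _ ≤ 9 / ε ^ 2 * (C * G ^ 2 / (L * G / ε) ^ 2) := by
              have h5 : (256 : ℝ) ^ J = (16 ^ J) ^ 2 := by
                rw [← pow_mul, mul_comm, pow_mul]; norm_num
              rw [h5]
              gcongr
          _ = 9 * C / L ^ 2 := by field_simp
          _ ≤ 1 / 16 := by
              rw [div_le_div_iff₀ (by positivity) (by norm_num)]
              have h6 := Real.sq_sqrt hC.le
              have h7 := Real.sqrt_nonneg C
              rw [hL]
              nlinarith
      have hfinal := expect_clusterPoint_le a x R hbad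
      have hsum : ((Proc.pi fun _ : Fin R => x).expect a fun v =>
          if clusterPoint (ε / 3) v ∈ {v | ‖v - g‖ ≤ ε} then (1 : ℝ) else 0) =
          1 - (Proc.pi fun _ : Fin R => x).expect a fun v =>
            if ‖clusterPoint (ε / 3) v - g‖ ≤ 3 * (ε / 3) then (0 : ℝ) else 1 := by
        rw [eq_sub_iff_add_eq, ← Proc.expect_add]
        refine Eq.trans ?_ (Proc.expect_const a (Proc.pi fun _ : Fin R => x) 1)
        congr 1
        funext v
        rw [show 3 * (ε / 3) = ε by ring]
        simp only [Set.mem_ofPred_eq]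
        split_ifs <;> norm_num
      rw [hsum]
      linarith

/-! ### Concentration of the Monte Carlo estimator -/

section Hoeffding

/-- Since `y ↦ cosh (c √y)` is convex, with a power series of nonnegative coefficients, the norm of
a vector is controlled by its coordinates. -/
lemma cosh_norm_le {d : ℕ} (hd : 0 < d) (c : ℝ) (v : EuclideanSpace ℝ (Fin d)) :
    Real.cosh (c * (‖v‖ / Real.sqrt d)) ≤ (d : ℝ)⁻¹ * ∑ j, Real.cosh (c * v j) := by
  have hd0 : (0 : ℝ) < d := by exact_mod_cast hd
  have h1 := Real.hasSum_cosh (c * (‖v‖ / Real.sqrt d))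
  have h2 : HasSum (fun k : ℕ => (d : ℝ)⁻¹ * ∑ j, (c * v j) ^ (2 * k) / (2 * k).factorial)
      ((d : ℝ)⁻¹ * ∑ j, Real.cosh (c * v j)) :=
    (hasSum_sum fun j _ => Real.hasSum_cosh (c * v j)).mul_left _
  refine hasSum_le (fun k => ?_) h1 h2
  rw [← Finset.sum_div, ← mul_div_assoc (d : ℝ)⁻¹]
  refine div_le_div_of_nonneg_right ?_ (by positivity)
  have hsq : (c * (‖v‖ / Real.sqrt d)) ^ 2 = ∑ j, (d : ℝ)⁻¹ * (c * v j) ^ 2 := by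
    rw [mul_pow, div_pow, Real.sq_sqrt hd0.le, EuclideanSpace.norm_sq_eq, ← Finset.mul_sum]
    simp only [Real.norm_eq_abs, sq_abs, mul_pow, ← Finset.mul_sum]
    ring
  rw [pow_mul, hsq, Finset.mul_sum]
  refine (Real.pow_arith_mean_le_arith_mean_pow Finset.univ (fun _ => (d : ℝ)⁻¹)
    (fun j => (c * v j) ^ 2) (fun j _ => by positivity) ?_ (fun j _ => sq_nonneg _) k).trans
    (le_of_eq ?_)
  · simp [hd0.ne']
  · simp only [← pow_mul]

variable {X : Type} [MeasurableSpace X] (D : Measure X) [IsProbabilityMeasure D]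

/-- Hoeffding's lemma for a sum of independent copies of a centered variable with values in an interval
of length `2c`. -/
lemma hasSubgaussianMGF_sum_pi {f : X → ℝ} (hf : Measurable f) {b : ℝ} {c : NNReal}
    (hb : ∀ᵐ r ∂D, f r ∈ Set.Icc b (b + 2 * c)) (h0 : ∫ r, f r ∂D = 0) (N : ℕ) :
    HasSubgaussianMGF (fun x : Fin N → X => ∑ i, f (x i)) (N * c ^ 2)
      (Measure.pi fun _ : Fin N => D) := by
  have h1 : HasSubgaussianMGF f (c ^ 2) D := by
    have h := hasSubgaussianMGF_of_mem_Icc_of_integral_eq_zero hf.aemeasurable hb h0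
    have e : (‖b + 2 * (c : ℝ) - b‖₊ / 2) ^ 2 = c ^ 2 := by
      congr 1
      ext
      simp
    rwa [e] at h
  have hind : iIndepFun (fun i (x : Fin N → X) => f (x i)) (Measure.pi fun _ : Fin N => D) :=
    iIndepFun_pi fun _ => hf.aemeasurable
  have hsum := HasSubgaussianMGF.sum_of_iIndepFun hind (c := fun _ => c ^ 2) (s := Finset.univ)
    (fun i _ => by
      have hmp := measurePreserving_eval (fun _ : Fin N => D) i
      have := HasSubgaussianMGF.of_map (Y := Function.eval i) (X := f)
        (μ := Measure.pi fun _ : Fin N => D) (c := c ^ 2) hmp.measurable.aemeasurable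
        (by rw [hmp.map_eq]; exact h1)
      exact this)
  simpa using hsum

/-- A Hoeffding inequality for random vectors, weaker than the scalar one by a factor `d` in the
exponent. -/
lemma measureReal_norm_sum_ge_le {d : ℕ} (hd : 0 < d) {f : X → EuclideanSpace ℝ (Fin d)}
    (hf : Measurable f) {B : ℝ} (hB : 0 < B) (hfB : ∀ᵐ r ∂D, ‖f r‖ ≤ B) (h0 : ∫ r, f r ∂D = 0)
    {N : ℕ} (hN : 0 < N) {t : ℝ} (ht : 0 ≤ t) :
    (Measure.pi fun _ : Fin N => D).real {x | t ≤ ‖∑ i, f (x i)‖} ≤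
      2 * Real.exp (-(t ^ 2 / (2 * d * N * B ^ 2))) := by
  set P := Measure.pi fun _ : Fin N => D with hP
  have hd0 : (0 : ℝ) < d := by exact_mod_cast hd
  have hN0 : (0 : ℝ) < N := by exact_mod_cast hN
  have hsd : 0 < Real.sqrt d := Real.sqrt_pos.2 hd0
  have hint : Integrable f D := Integrable.of_bound hf.aestronglyMeasurable B hfB
  have hsub : ∀ j, HasSubgaussianMGF (fun x : Fin N → X => ∑ i, f (x i) j)
      (N * (B.toNNReal) ^ 2) P := by
    intro j
    refine hasSubgaussianMGF_sum_pi D (f := fun r => f r j) (b := -B) ?_ ?_ ?_ N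
    · fun_prop
    · filter_upwards [hfB] with r hr
      have h1 : |f r j| ≤ B := (PiLp.norm_apply_le (f r) j).trans hr
      rw [Real.coe_toNNReal _ hB.le]
      exact ⟨(abs_le.1 h1).1, by linarith [(abs_le.1 h1).2]⟩
    · have h1 := (EuclideanSpace.proj (𝕜 := ℝ) j :
        EuclideanSpace ℝ (Fin d) →L[ℝ] ℝ).integral_comp_comm hint
      rw [h0, map_zero] at h1
      exact h1
  -- the minimizer of the exponent `N B² c² / 2 - c t / √d`
  set c : ℝ := t / (N * B ^ 2 * Real.sqrt d) with hc
  have hc0 : 0 ≤ c := by positivity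
  set F : (Fin N → X) → ℝ := fun x => (d : ℝ)⁻¹ * ∑ j, Real.cosh (c * ∑ i, f (x i) j) with hF
  have hcosh_int : ∀ j, Integrable (fun x : Fin N → X => Real.cosh (c * ∑ i, f (x i) j)) P := by
    intro j
    simp only [Real.cosh_eq]
    refine (((hsub j).integrable_exp_mul c).add ?_).div_const 2
    simpa only [neg_mul] using (hsub j).integrable_exp_mul (-c)
  have hcosh_le : ∀ j, ∫ x, Real.cosh (c * ∑ i, f (x i) j) ∂P ≤
      Real.exp (N * B ^ 2 * c ^ 2 / 2) := by
    intro j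
    have e1 := (hsub j).mgf_le c
    have e2 := (hsub j).mgf_le (-c)
    have i1 := (hsub j).integrable_exp_mul c
    have i2 := (hsub j).integrable_exp_mul (-c)
    simp only [mgf, neg_sq, NNReal.coe_mul, NNReal.coe_natCast, NNReal.coe_pow,
      Real.coe_toNNReal _ hB.le] at e1 e2
    simp only [Real.cosh_eq, ← neg_mul]
    rw [integral_div, integral_add i1 i2]
    linarith
  have hFint : Integrable F P := (integrable_finsetSum _ fun j _ => hcosh_int j).const_mul _
  have hFle : ∫ x, F x ∂P ≤ Real.exp (N * B ^ 2 * c ^ 2 / 2) := by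
    simp only [hF]
    rw [integral_const_mul, integral_finsetSum _ fun j _ => hcosh_int j]
    calc _ ≤ (d : ℝ)⁻¹ * ∑ _j : Fin d, Real.exp (N * B ^ 2 * c ^ 2 / 2) := by
          gcongr with j
          exact hcosh_le j
      _ = _ := by simp [hd0.ne']
  have hF0 : 0 ≤ᵐ[P] F := Filter.Eventually.of_forall fun x =>
    mul_nonneg (by positivity) (Finset.sum_nonneg fun j _ => (Real.cosh_pos _).le)
  have hmarkov := mul_meas_ge_le_integral_of_nonneg hF0 hFint (Real.exp (c * (t / Real.sqrt d)) / 2)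
  have hsubset : {x : Fin N → X | t ≤ ‖∑ i, f (x i)‖} ⊆
      {x | Real.exp (c * (t / Real.sqrt d)) / 2 ≤ F x} := by
    intro x hx
    have hx' : t ≤ ‖∑ i, f (x i)‖ := hx
    have h1 := cosh_norm_le hd c (∑ i, f (x i))
    have h2 : ∀ j, (∑ i, f (x i)) j = ∑ i, f (x i) j := by intro j; simp
    simp only [h2] at h1
    change _ ≤ F x
    refine le_trans ?_ h1
    rw [Real.cosh_eq]
    have h3 : Real.exp (c * (t / Real.sqrt d)) ≤
        Real.exp (c * (‖∑ i, f (x i)‖ / Real.sqrt d)) := by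
      apply Real.exp_le_exp.2
      gcongr
    linarith [Real.exp_pos (-(c * (‖∑ i, f (x i)‖ / Real.sqrt d)))]
  have h1 : P.real {x : Fin N → X | t ≤ ‖∑ i, f (x i)‖} ≤
      P.real {x | Real.exp (c * (t / Real.sqrt d)) / 2 ≤ F x} := measureReal_mono hsubset
  have h2 : Real.exp (c * (t / Real.sqrt d)) / 2 *
      P.real {x : Fin N → X | t ≤ ‖∑ i, f (x i)‖} ≤ Real.exp (N * B ^ 2 * c ^ 2 / 2) :=
    (mul_le_mul_of_nonneg_left h1 (by positivity)).trans (hmarkov.trans hFle)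
  have h3 : P.real {x : Fin N → X | t ≤ ‖∑ i, f (x i)‖} ≤
      2 * (Real.exp (N * B ^ 2 * c ^ 2 / 2) / Real.exp (c * (t / Real.sqrt d))) := by
    rw [mul_div_assoc', le_div_iff₀ (Real.exp_pos _)]
    linarith
  refine h3.trans (le_of_eq ?_)
  rw [← Real.exp_sub]
  congr 2
  have hs : Real.sqrt d ^ 2 = d := Real.sq_sqrt hd0.le
  rw [hc]
  generalize Real.sqrt d = s at hs hsd ⊢
  rw [← hs]
  field_simp
  ring

end Hoeffding

section MonteCarlo

variable {d : ℕ}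

open Classical in
/-- The error of the Monte Carlo estimator is the sum of the deviations from `g` in the tail, divided
by the number of samples in the tail. -/
lemma monteCarloEstimator_sub {N : ℕ} (w : EuclideanSpace ℝ (Fin d)) (z : ℝ)
    (g : EuclideanSpace ℝ (Fin d)) (x : Fin N → EuclideanSpace ℝ (Fin d))
    (hx : (∑ i, (tailEvent w z).indicator (fun _ => (1 : ℝ)) (x i)) ≠ 0) :
    monteCarloEstimator w z x - g =
      (∑ i, (tailEvent w z).indicator (fun _ => (1 : ℝ)) (x i))⁻¹ •
        ∑ i, (tailEvent w z).indicator (fun r => -r - g) (x i) := by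
  have h1 : (∑ i, (tailEvent w z).indicator (fun _ => (1 : ℝ)) (x i)) =
      ((Finset.univ.filter fun i => x i ∈ tailEvent w z).card : ℝ) := by
    simp [Set.indicator_apply]
  have h2 : ∑ i, (tailEvent w z).indicator (fun r => -r - g) (x i) =
      ∑ i ∈ Finset.univ.filter (fun i => x i ∈ tailEvent w z), (-(x i) - g) := by
    simp [Set.indicator_apply, Finset.sum_ite]
  rw [h1] at hx ⊢
  rw [h2, monteCarloEstimator, Finset.sum_sub_distrib, Finset.sum_const, smul_sub,
    ← Nat.cast_smul_eq_nsmul ℝ, smul_smul, inv_mul_cancel₀ hx, one_smul]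

lemma norm_monteCarloEstimator_le {N : ℕ} {G : ℝ} (hG : 0 ≤ G) (w : EuclideanSpace ℝ (Fin d))
    (z : ℝ) (x : Fin N → EuclideanSpace ℝ (Fin d)) (hx : ∀ i, ‖x i‖ ≤ G) :
    ‖monteCarloEstimator w z x‖ ≤ G := by
  classical
  rw [monteCarloEstimator, norm_smul, norm_inv, Real.norm_of_nonneg (Nat.cast_nonneg _)]
  set A := Finset.univ.filter fun i => x i ∈ tailEvent w z
  have h1 : ‖∑ i ∈ A, -(x i)‖ ≤ A.card * G := by
    refine (norm_sum_le _ _).trans ?_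
    rw [← nsmul_eq_mul]
    exact Finset.sum_le_card_nsmul _ _ _ fun i _ => by rw [norm_neg]; exact hx i
  calc _ ≤ (A.card : ℝ)⁻¹ * (A.card * G) := by gcongr
    _ = ((A.card : ℝ)⁻¹ * A.card) * G := by ring
    _ ≤ 1 * G := by gcongr; exact inv_mul_le_one
    _ = G := one_mul G

/-- The Monte Carlo estimator of the CVaR subgradient. The deviations `-r - g` in the tail are
centered, and the number of samples in the tail is at least half of its smallest possible mean. -/
lemma monteCarlo_le {α G : ℝ} (hα0 : 0 < α) (hα1 : α < 1) (hG : 0 < G) {ε η : ℝ} (hε : 0 < ε)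
    (hη : 0 < η) (hη2 : η ≤ 1 / 2) (D : Measure (EuclideanSpace ℝ (Fin d)))
    (w : EuclideanSpace ℝ (Fin d)) (N : ℕ) [IsProbabilityMeasure D] (hD : ∀ᵐ r ∂D, ‖r‖ ≤ G)
    (hN : 96 * G ^ 2 / (1 - α) ^ 2 * ((d : ℝ) / ε ^ 2 * Real.log (1 / η)) ≤ N) :
    1 - η ≤ (Measure.pi fun _ : Fin N => D).real
      {x | ‖monteCarloEstimator w (valueAtRisk α D w) x - cvarSubgradient α D w‖ ≤ ε} := by
  set P := Measure.pi fun _ : Fin N => D with hP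
  set T := tailEvent w (valueAtRisk α D w) with hT
  set g := cvarSubgradient α D w with hg
  set q := D.real T with hq
  have hTm : MeasurableSet T := measurableSet_tailEvent w _
  have hgG : ‖g‖ ≤ G := norm_cvarSubgradient_le hG.le D w hD
  have hqα : 1 - α ≤ q := one_sub_le_tail_valueAtRisk hα0 D w hD
  have hβ : 0 < 1 - α := by linarith
  rcases Nat.eq_zero_or_pos d with hd | hd
  · subst hd
    have : {x : Fin N → EuclideanSpace ℝ (Fin 0) |
        ‖monteCarloEstimator w (valueAtRisk α D w) x - g‖ ≤ ε} = Set.univ := by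
      ext x
      refine iff_of_true ?_ trivial
      change ‖_‖ ≤ ε
      rw [Subsingleton.elim (monteCarloEstimator w (valueAtRisk α D w) x) g, sub_self, norm_zero]
      exact hε.le
    rw [this, probReal_univ]
    linarith
  -- for large `ε` the bound on `N` does not force any sample to lie in the tail
  rcases le_or_gt (2 * G) ε with hεG | hεG
  · -- both vectors have norm at most `G`
    have hall : ∀ᵐ x ∂P, ∀ i, ‖x i‖ ≤ G := by
      rw [ae_all_iff]
      intro i
      exact (measurePreserving_eval (fun _ : Fin N => D) i).quasiMeasurePreserving.ae hD
    have hae : {x | ‖monteCarloEstimator w (valueAtRisk α D w) x - g‖ ≤ ε} =ᵐ[P] Set.univ := by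
      rw [Filter.eventuallyEq_set]
      filter_upwards [hall] with x hx
      have h1 := norm_monteCarloEstimator_le hG.le w (valueAtRisk α D w) x hx
      have h2 := norm_sub_le (monteCarloEstimator w (valueAtRisk α D w) x) g
      refine iff_of_true ?_ trivial
      linarith
    rw [measureReal_congr hae, probReal_univ]
    linarith
  have hd1 : (1 : ℝ) ≤ d := by exact_mod_cast hd
  set l := Real.log (1 / η) with hl
  have hl0 : 0 < l := Real.log_pos (by rw [lt_div_iff₀ hη]; linarith)
  have hexp : Real.exp (-l) = η := by rw [hl, Real.exp_neg, Real.exp_log (by positivity)]; simp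
  have hN0 : (0 : ℝ) < N := lt_of_lt_of_le (by positivity) hN
  have hNpos : 0 < N := by exact_mod_cast hN0
  -- the indicator of the tail and the deviation from `g`, both centered
  set u : EuclideanSpace ℝ (Fin d) → ℝ := fun r => q - T.indicator (fun _ => (1 : ℝ)) r with hu
  set f : EuclideanSpace ℝ (Fin d) → EuclideanSpace ℝ (Fin d) := T.indicator (fun r => -r - g)
    with hf
  have hfint : Integrable (fun r : EuclideanSpace ℝ (Fin d) => -r) D :=
    Integrable.of_bound (by fun_prop) G (by filter_upwards [hD] with r hr; rwa [norm_neg])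
  have hf0 : ∫ r, f r ∂D = 0 := by
    rw [hf, integral_indicator hTm, integral_sub hfint.integrableOn (integrable_const _),
      setIntegral_const]
    have : g = q⁻¹ • ∫ r in T, -r ∂D := cvarSubgradient_eq α D w
    rw [this, smul_smul, ← hq, mul_inv_cancel₀ (by linarith), one_smul, sub_self]
  have hfB : ∀ᵐ r ∂D, ‖f r‖ ≤ 2 * G := by
    filter_upwards [hD] with r hr
    rw [hf]
    refine (norm_indicator_le_norm_self _ _).trans ((norm_sub_le _ _).trans ?_)
    rw [norm_neg]
    linarith
  have hfm : Measurable f := (by fun_prop : Measurable fun r => -r - g).indicator hTm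
  have hum : Measurable u := measurable_const.sub (measurable_const.indicator hTm)
  have hu0 : ∫ r, u r ∂D = 0 := by
    have h1 : Integrable (T.indicator fun _ => (1 : ℝ)) D := (integrable_const 1).indicator hTm
    rw [hu, integral_sub (integrable_const _) h1, integral_indicator hTm]
    simp [hq]
  have hub : ∀ᵐ r ∂D, u r ∈ Set.Icc (q - 1) (q - 1 + 2 * ((1 / 2 : NNReal) : ℝ)) := by
    refine Filter.Eventually.of_forall fun r => ?_
    by_cases hr : r ∈ T <;> simp [hu, hr]
  set t := ε * (N * (1 - α) / 2) with ht
  have hb1 : P.real {x | t ≤ ‖∑ i, f (x i)‖} ≤ η / 2 := by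
    refine (measureReal_norm_sum_ge_le D hd hfm (by positivity) hfB hf0 hNpos
      (by positivity)).trans ?_
    have h1 : 3 * l ≤ t ^ 2 / (2 * d * N * (2 * G) ^ 2) := by
      have h2 : t ^ 2 / (2 * d * N * (2 * G) ^ 2) = N * ((1 - α) ^ 2 * ε ^ 2 / (32 * d * G ^ 2)) := by
        rw [ht]; field_simp; ring
      rw [h2]
      calc 3 * l = (96 * G ^ 2 / (1 - α) ^ 2 * (d / ε ^ 2 * l)) *
            ((1 - α) ^ 2 * ε ^ 2 / (32 * d * G ^ 2)) := by field_simp; norm_num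
        _ ≤ _ := by gcongr
    have h3 : Real.exp (-(t ^ 2 / (2 * d * N * (2 * G) ^ 2))) ≤ η ^ 3 := by
      calc _ ≤ Real.exp (-(3 * l)) := Real.exp_le_exp.2 (by linarith)
        _ = Real.exp (-l) ^ 3 := by rw [← Real.exp_nat_mul]; congr 1; push_cast; ring
        _ = η ^ 3 := by rw [hexp]
    have h4 : η ^ 3 ≤ (1 / 2) ^ 2 * η := by
      rw [pow_succ]; gcongr
    linarith
  have hb2 : P.real {x | N * (1 - α) / 2 ≤ ∑ i, u (x i)} ≤ η / 2 := by
    refine ((hasSubgaussianMGF_sum_pi D hum hub hu0 N).measure_ge_le (by positivity)).trans ?_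
    have h1 : 2 * l ≤ N * (1 - α) ^ 2 / 2 := by
      have h5 : ε ^ 2 ≤ (2 * G) ^ 2 := by gcongr
      have h6 : 1 / (2 * G) ^ 2 * l ≤ d / ε ^ 2 * l := by gcongr
      calc 2 * l ≤ (96 * G ^ 2 / (1 - α) ^ 2 * (1 / (2 * G) ^ 2 * l)) * ((1 - α) ^ 2 / 2) := by
            have : (96 * G ^ 2 / (1 - α) ^ 2 * (1 / (2 * G) ^ 2 * l)) * ((1 - α) ^ 2 / 2) =
              12 * l := by field_simp; norm_num
            rw [this]; linarith
        _ ≤ (96 * G ^ 2 / (1 - α) ^ 2 * (d / ε ^ 2 * l)) * ((1 - α) ^ 2 / 2) := by gcongr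
        _ ≤ N * ((1 - α) ^ 2 / 2) := by gcongr
        _ = _ := by ring
    have h2 : -(N * (1 - α) / 2) ^ 2 / (2 * ((N * (1 / 2) ^ 2 : NNReal) : ℝ)) =
        -(N * (1 - α) ^ 2 / 2) := by
      push_cast
      field_simp
    rw [h2]
    calc _ ≤ Real.exp (-(2 * l)) := Real.exp_le_exp.2 (by linarith)
      _ = Real.exp (-l) ^ 2 := by rw [← Real.exp_nat_mul]; congr 1; push_cast; ring
      _ = η ^ 2 := by rw [hexp]
      _ ≤ η / 2 := by nlinarith
  set A := {x : Fin N → EuclideanSpace ℝ (Fin d) |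
    ‖monteCarloEstimator w (valueAtRisk α D w) x - g‖ ≤ ε} with hA
  have hsub : Aᶜ ⊆ {x | t ≤ ‖∑ i, f (x i)‖} ∪ {x | N * (1 - α) / 2 ≤ ∑ i, u (x i)} := by
    intro x hx
    by_contra hcon
    simp only [Set.mem_union, Set.mem_ofPred_eq, not_or, not_le] at hcon
    obtain ⟨h1, h2⟩ := hcon
    apply hx
    set k := ∑ i, T.indicator (fun _ => (1 : ℝ)) (x i) with hk
    have h3 : ∑ i, u (x i) = N * q - k := by
      simp [hu, hk, Finset.sum_sub_distrib]
    rw [h3] at h2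
    have hk0 : N * (1 - α) / 2 < k := by nlinarith
    have hk1 : 0 < k := lt_trans (by positivity) hk0
    change ‖_‖ ≤ ε
    rw [monteCarloEstimator_sub w _ g x hk1.ne', norm_smul, norm_inv, Real.norm_of_nonneg hk1.le]
    calc _ ≤ k⁻¹ * (ε * k) := by
          gcongr
          refine h1.le.trans ?_
          rw [ht]
          gcongr
      _ = ε := by field_simp
  have h1 : P.real Aᶜ ≤ η / 2 + η / 2 :=
    (measureReal_mono hsub).trans ((measureReal_union_le _ _).trans (add_le_add hb1 hb2))
  have h2 : (1 : ℝ) ≤ P.real A + P.real Aᶜ := by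
    rw [← probReal_univ (μ := P), ← Set.union_compl_self A]
    exact measureReal_union_le _ _
  linarith

end MonteCarlo

end

theorem proposition2 (α G : ℝ) (hα0 : 0 < α) (hα1 : α < 1) (hG : 0 < G) :
    ∃ C : ℝ, 0 < C ∧
      ∀ (d : ℕ) (ε η : ℝ), 0 < ε → 0 < η → η ≤ 1 / 2 →
        (∃ E : QAEstimator d,
          (E.queries : ℝ) ≤ C * ((d : ℝ) / ε * Real.log (1 / η)) ∧
          ∀ (n : ℕ) (O : ScenarioOracle n d) (w : EuclideanSpace ℝ (Fin d)),
            (∀ᵐ r ∂O.law, ‖r‖ ≤ G) →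
            1 - η ≤ E.prob O w (valueAtRisk α O.law w)
              {v | ‖v - cvarSubgradient α O.law w‖ ≤ ε}) ∧
        (∀ (D : Measure (EuclideanSpace ℝ (Fin d))) (w : EuclideanSpace ℝ (Fin d)) (N : ℕ),
          IsProbabilityMeasure D →
          (∀ᵐ r ∂D, ‖r‖ ≤ G) →
          C * ((d : ℝ) / ε ^ 2 * Real.log (1 / η)) ≤ (N : ℝ) →
          1 - η ≤ (Measure.pi fun _ : Fin N => D).real
            {x | ‖monteCarloEstimator w (valueAtRisk α D w) x - cvarSubgradient α D w‖ ≤ ε}) := by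
  obtain ⟨C, hC, h⟩ := exists_cvarEstimator hα0 hα1 hG
  have hβ : 0 < 1 - α := by linarith
  refine ⟨max C (96 * G ^ 2 / (1 - α) ^ 2), lt_max_of_lt_left hC, fun d ε η hε hη hη2 => ?_⟩
  have hlog : 0 ≤ Real.log (1 / η) := Real.log_nonneg (by rw [le_div_iff₀ hη]; linarith)
  refine ⟨?_, fun D w N _ hD hN => monteCarlo_le hα0 hα1 hG hε hη hη2 D w N hD
    (le_trans (by gcongr; exact le_max_right _ _) hN)⟩
  obtain ⟨E, hE, hprob⟩ := h d ε η hε hη hη2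
  exact ⟨E, hE.trans (by gcongr; exact le_max_left _ _), hprob⟩
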